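/- **Setting.** For $\alpha,\beta,c\in\mathbb C$ with $c\neq\pm1$ and $\alpha+\beta+2n\ne 0$ for all integers $n\ge 1$, let $(Q_n(x;\alpha,\beta,c))_{n\ge0}$ be the monic big $-1$ Jacobi polynomials: $Q_{-1}=0$, $Q_0=1$, $xQ_n=Q_{n+1}+b_nQ_n+u_nQ_{n-1}$, where $$b_n=\begin{cases}-c+\frac{(c-1)n}{\alpha+\beta+2n}+\frac{(c+1)(\beta+n+1)}{\alpha+\beta+2n+2}& n\text{ even},\\ c-\frac{(c-1)(n+1)}{\alpha+\beta+2n+2}-\frac{(c+1)(\beta+n)}{\alpha+\beta+2n}& n\text{ odd},\end{cases}\qquad u_n=\begin{cases}\frac{(c-1)^2n(\alpha+\beta+n)}{(\alpha+\beta+2n)^2}& n\text{ even},\\ \frac{(c+1)^2(\alpha+n)(\beta+n)}{(\alpha+\beta+2n)^2}& n\text{ odd}\end{cases}$$ (the term $\frac{(c-1)n}{\alpha+\beta+2n}$ being $0$ for $n=0$). Let $\mathbf u=\mathbf u^{(\alpha,\beta,c)}$ be the linear functional on $\mathbb C[x]$ given by $$\langle\mathbf u,p\rangle=\int_{[-c,-1]\cup[1,c]}p(x)\,\tfrac{x}{|x|}(x+1)(c-x)(x^2-1)^{\frac{\alpha-1}2}(c^2-x^2)^{\frac{\beta-1}2}\,dx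 ,$$ continued analytically in the parameters. Explicitly, with principal powers, $$\langle\mathbf u,x^{2k}\rangle=(c-1)M_k,\quad \langle\mathbf u,x^{2k+1}\rangle=cM_k-M_{k+1},\quad M_k=(c^2-1)^{\frac{\alpha+\beta}2}\sum_{j=0}^k\binom kj(c^2-1)^j\frac{\Gamma(\frac{\alpha+1}2+j)\Gamma(\frac{\beta+1}2)}{\Gamma(\frac{\alpha+\beta}2+1+j)} .$$ Put $h_n(\alpha,\beta,c)=\langle\mathbf u,1\rangle\,r_n(\alpha,\beta,c)$, where, with $(a,b)_k=(a)_k(b)_k$, $$r_n=\begin{cases}\dfrac{(c^2-1)^n(\frac n2)!\,(\frac{\alpha+1}2,\frac{\beta+1}2)_{n/2}}{(\frac{\alpha+\beta}2+1)_n(\frac{\alpha+\beta+n}2+1)_{n/2}}& n\text{ even},\\[3mm] \dfrac{(c-1)^{n-1}(c+1)^{n+1}(\frac{n-1}2)!\,(\frac{\alpha+1}2,\frac{\beta+1}2)_{(n+1)/2}}{(\frac{\alpha+\beta}2+1)_n(\frac{\alpha+\beta+n+1}2)_{(n+1)/2}}& n\text{ odd}.\end{cases}$$ Let $\tau_\alpha,\tau_\beta$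 be the linear operators on $\mathbb C[x]$ with $\tau_\alpha[Q_n(x;\alpha,\beta,c)]=Q_{n-1}(-x;\alpha+2,\beta,-c)$ and $\tau_\beta[Q_n(x;\alpha,\beta,c)]=Q_{n-1}(x;\alpha,\beta+2,-c)$. When they are iterated, each application acts with the parameters, and in the variable, produced by the previous one. **Theorem.** Let $N\in\mathbb N_0$, $c\in\mathbb C$, $c\ne\pm1$. (a) *Weight.* If $\operatorname{Re}\alpha,\operatorname{Re}\beta>-1$, then $\mathbf u^{(\alpha,\beta,c)}$ is given by absolutely convergent integrals of the above weight: for real $c$, the sum of the oriented integrals $\int_{-|c|}^{-1}$ and $\int_1^{|c|}$ (with principal powers); for every complex $c\neq\pm1$, the corresponding integral along the two curves $x=\pm\sqrt{1+(c^2-1)s}$, $0\le s\le1$ (with the sign $x/|x|$ read as $+1$ on the first and $-1$ on the second). (b) *Norms.* If $\alpha+\beta+2n\neq0$ for all $n\ge1$ and neither $\alpha$ nor $\beta$ is a negative odd integer, then for all $n,m\ge 0$ $\langle\mathbf u,Q_nQ_m\rangle=h_n\delta_{nm}$, $h_n\ne0$, and $h_n=u_nh_{n-1}$ for $n\ge1$.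 (c) *Case $\alpha=-2N-1$.* Let $\beta\in\mathbb C$ with $\alpha+\beta+2n\ne0$ for all $n\ge1$. Then for $n\geq 1$ one has $u_n=0$ exactly for $n=2N+1$; $Q_{2N+1}(x)=(x^2-1)^N(x-1)$; $\tau_\alpha^{2N+1}Q_n=0$ for $n\le 2N$, and $\tau_\alpha^{2N+1}Q_n=Q_{n-2N-1}(-x;2N+1,\beta,-c)$ for $n\ge2N+1$. The limit $\lambda_N(\beta)=\lim_{t\to-2N-1}h_{2N+1}(t,\beta,c)$ exists and is nonzero. There is a linear functional $\ell_0$ on $\mathbb C[x]$ with $\ell_0(1)=1$, which is a linear combination of the functionals $f\mapsto f^{(j)}(1)$, $0\le j\le N$, and $f\mapsto f^{(j)}(-1)$, $0\le j\le N-1$, such that, with $\mathscr L_0(p,q)=\ell_0(pq)$ and $\langle\mathbf u_1,f\rangle=\langle\mathbf u^{(2N+1,\beta,-c)},f(-x)\rangle$, the polynomials $Q_n=Q_n(x;-2N-1,\beta,c)$ are orthogonal with respect to $$\langle p,q\rangle_1=\mathscr L_0(p,q)+\lambda_N(\beta)\,\langle\mathbf u_1,(\tau_\alpha^{2N+1}p)(\tau_\alpha^{2N+1}q)\rangle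 ,$$ i.e. $\langle Q_n,Q_m\rangle_1=0$ for $n\ne m$ and $\langle Q_n,Q_n\rangle_1\neq0$ for all $n$. The norms are $\langle Q_n,Q_n\rangle_1=r_n(-2N-1,\beta,c)$ for $n\le2N$ and $\langle Q_n,Q_n\rangle_1=\lambda_N(\beta)\,h_{n-2N-1}(2N+1,\beta,-c)$ for $n\ge2N+1$. For $n\ge 2N+1$ moreover $\lim_{t\to-2N-1}h_n(t,\beta,c)=\lambda_N(\beta)\,r_{n-2N-1}(2N+1,\beta,-c)$. Finally $\langle Q_n,Q_n\rangle_1=u_n\langle Q_{n-1},Q_{n-1}\rangle_1$ for all $n\ge1$, $n\ne2N+1$. (d) *Case $\beta=-2N-1$.* Let $\alpha\in\mathbb C$ with $\alpha+\beta+2n\ne0$ for all $n\ge1$. Then for $n\geq 1$ one has $u_n=0$ exactly for $n=2N+1$; $Q_{2N+1}(x)=(x^2-c^2)^N(x+c)$; $\tau_\beta^{2N+1}Q_n=0$ for $n\le2N$, and $\tau_\beta^{2N+1}Q_n=Q_{n-2N-1}(x;\alpha,2N+1,-c)$ for $n\ge2N+1$. The limit $\lambda_N(\alpha)=\lim_{t\to-2N-1}h_{2N+1}(t,\alpha,c)$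 exists and is nonzero. There is a linear functional $\ell_1$ with $\ell_1(1)=1$, which is a linear combination of the functionals $f\mapsto f^{(j)}(z)$ with $z$ a zero of $(x^2-c^2)^N(x+c)$ and $j$ less than its multiplicity (for $c\ne0$: $z=-c$, $j\le N$, and $z=c$, $j\le N-1$), such that, with $\mathscr L_1(p,q)=\ell_1(pq)$ and $\mathbf u_2=\mathbf u^{(\alpha,2N+1,-c)}$, the polynomials $Q_n=Q_n(x;\alpha,-2N-1,c)$ are orthogonal, in the same sense, with respect to $$\langle p,q\rangle_2=\mathscr L_1(p,q)+\lambda_N(\alpha)\,\langle\mathbf u_2,(\tau_\beta^{2N+1}p)(\tau_\beta^{2N+1}q)\rangle .$$ The norms are $r_n(\alpha,-2N-1,c)$ for $n\le2N$ and $\lambda_N(\alpha)\,h_{n-2N-1}(\alpha,2N+1,-c)$ for $n\ge2N+1$. For $n\ge 2N+1$ moreover $\lim_{t\to-2N-1}h_n(\alpha,t,c)=\lambda_N(\alpha)\,r_{n-2N-1}(\alpha,2N+1,-c)$. Finally $\langle Q_n,Q_n\rangle_2=u_n\langle Q_{n-1},Q_{n-1}\rangle_2$ for all $n\ge1$, $n\ne2N+1$.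 -/

import Mathlib

open Polynomial Filter Topology MeasureTheory

noncomputable section

namespace BigJacobi

/-- The recurrence coefficient `b_n(α, β, c)`. (For `n = 0` and `α + β = 0` the term
`(c - 1) * 0 / 0` is `0`, its value for all other parameters.) -/
def bCoeff (α β c : ℂ) (n : ℕ) : ℂ :=
  if Even n then
    -c + (c - 1) * n / (α + β + 2 * n) + (c + 1) * (β + n + 1) / (α + β + 2 * n + 2)
  else
    c - (c - 1) * (n + 1) / (α + β + 2 * n + 2) - (c + 1) * (β + n) / (α + β + 2 * n)

/-- The recurrence coefficient `u_n(α, β, c)`. -/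
def uCoeff (α β c : ℂ) (n : ℕ) : ℂ :=
  if Even n then
    (c - 1) ^ 2 * n * (α + β + n) / (α + β + 2 * n) ^ 2
  else
    (c + 1) ^ 2 * (α + n) * (β + n) / (α + β + 2 * n) ^ 2

/-- The monic big `-1` Jacobi polynomials `Q_n^{(0)}(x; α, β, c)`, given by
`x Q_n = Q_{n+1} + b_n Q_n + u_n Q_{n-1}`, `Q_0 = 1`, `Q_{-1} = 0`. -/
def Q (α β c : ℂ) : ℕ → ℂ[X]
  | 0 => 1
  | 1 => X - C (bCoeff α β c 0)
  | n + 2 => (X - C (bCoeff α β c (n + 1))) * Q α β c (n + 1)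
      - C (uCoeff α β c (n + 1)) * Q α β c n

theorem Q_monic_degree (α β c : ℂ) (n : ℕ) :
    ((Q α β c n).Monic ∧ (Q α β c n).degree = n) ∧
      ((Q α β c (n + 1)).Monic ∧ (Q α β c (n + 1)).degree = ((n + 1 : ℕ) : WithBot ℕ)) := by
  induction n with
  | zero =>
    refine ⟨⟨by simp [Q], by simp [Q]⟩, ?_, ?_⟩
    · exact monic_X_sub_C _
    · simp [Q]
  | succ n ih =>
    obtain ⟨⟨-, h0⟩, h1m, h1⟩ := ih
    refine ⟨⟨h1m, h1⟩, ?_⟩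
    have hm : ((X - C (bCoeff α β c (n + 1))) * Q α β c (n + 1)).Monic :=
      (monic_X_sub_C _).mul h1m
    have hd : ((X - C (bCoeff α β c (n + 1))) * Q α β c (n + 1)).degree
        = ((n + 2 : ℕ) : WithBot ℕ) := by
      rw [degree_mul, degree_X_sub_C, h1]
      norm_cast
      omega
    have hlt : (C (uCoeff α β c (n + 1)) * Q α β c n).degree
        < ((X - C (bCoeff α β c (n + 1))) * Q α β c (n + 1)).degree := by
      rw [hd]
      rw [C_mul']
      refine lt_of_le_of_lt (degree_smul_le _ _) ?_
      rw [h0]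
      exact_mod_cast (by omega : n < n + 2)
    constructor
    · exact hm.sub_of_left hlt
    · rw [Q, degree_sub_eq_left_of_degree_lt hlt, hd]

/-- The polynomials `Q_n`, as a sequence with `deg Q_n = n`. -/
def QSeq (α β c : ℂ) : Polynomial.Sequence ℂ where
  elems' := Q α β c
  degree_eq' n := (Q_monic_degree α β c n).1.2

theorem QSeq_isUnit (α β c : ℂ) (n : ℕ) : IsUnit ((QSeq α β c) n).leadingCoeff := by
  have h : (Q α β c n).leadingCoeff = 1 := (Q_monic_degree α β c n).1.1
  change IsUnit (Q α β c n).leadingCoeff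
  rw [h]
  exact isUnit_one

/-- The basis `(Q_n)` of the space of polynomials. -/
def QBasis (α β c : ℂ) : Module.Basis ℕ ℂ ℂ[X] := (QSeq α β c).basis (QSeq_isUnit α β c)

/-- The reflection `p(x) ↦ p(-x)`. -/
def reflectX : ℂ[X] →ₗ[ℂ] ℂ[X] := (Polynomial.aeval (-X : ℂ[X])).toLinearMap

/-- The lowering operator `τ_α`:
`Q_n(x; α, β, c) ↦ Q_{n-1}(-x; α + 2, β, -c)`, where `Q_{-1} = 0`. -/
def tauAlpha (α β c : ℂ) : ℂ[X] →ₗ[ℂ] ℂ[X] :=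
  (QBasis α β c).constr ℂ fun n =>
    match n with
    | 0 => 0
    | m + 1 => reflectX (Q (α + 2) β (-c) m)

/-- The lowering operator `τ_β`:
`Q_n(x; α, β, c) ↦ Q_{n-1}(x; α, β + 2, -c)`, where `Q_{-1} = 0`. -/
def tauBeta (α β c : ℂ) : ℂ[X] →ₗ[ℂ] ℂ[X] :=
  (QBasis α β c).constr ℂ fun n =>
    match n with
    | 0 => 0
    | m + 1 => Q α (β + 2) (-c) m

/-- The iterated operator `τ_α^k`. One application of `τ_α` turns the parameters `(α, β, c)` into
`(α + 2, β, -c)` and the variable `x` into `-x`; the next one acts with the new parameters and in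
the new variable, which is what the two conjugating reflections express. -/
def tauAlphaPow : ℕ → ℂ → ℂ → ℂ → (ℂ[X] →ₗ[ℂ] ℂ[X])
  | 0, _, _, _ => LinearMap.id
  | k + 1, α, β, c =>
      reflectX ∘ₗ tauAlphaPow k (α + 2) β (-c) ∘ₗ reflectX ∘ₗ tauAlpha α β c

/-- The iterated operator `τ_β^k`; one application turns `(α, β, c)` into `(α, β + 2, -c)`. -/
def tauBetaPow : ℕ → ℂ → ℂ → ℂ → (ℂ[X] →ₗ[ℂ] ℂ[X])
  | 0, _, _, _ => LinearMap.id
  | k + 1, α, β, c => tauBetaPow k α (β + 2) (-c) ∘ₗ tauBeta α β c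

/-- `∫_1^{c²} t^k (t - 1)^{(α-1)/2} (c² - t)^{(β-1)/2} dt`, evaluated by Euler's Beta integral, and
thereby continued analytically in `α` and `β`. -/
def betaMoment (α β c : ℂ) (k : ℕ) : ℂ :=
  (c ^ 2 - 1) ^ ((α + β) / 2) * ∑ j ∈ Finset.range (k + 1),
    (k.choose j : ℂ) * (c ^ 2 - 1) ^ j *
      (Complex.Gamma ((α + 1) / 2 + j) * Complex.Gamma ((β + 1) / 2) /
        Complex.Gamma ((α + 1) / 2 + (β + 1) / 2 + j))

/-- The factor `(x + 1)(c - x)(x² - 1)^{(α-1)/2}(c² - x²)^{(β-1)/2}` of the weight, with principal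
powers. -/
def weight (α β c x : ℂ) : ℂ :=
  (x + 1) * (c - x) * (x ^ 2 - 1) ^ ((α - 1) / 2) * (c ^ 2 - x ^ 2) ^ ((β - 1) / 2)

/-- The weight functional `u = u(α, β, c)`: integration against
`(x / |x|) (x + 1) (c - x) (x² - 1)^{(α-1)/2} (c² - x²)^{(β-1)/2}` over `[-c, -1] ∪ [1, c]`,
continued analytically in the parameters. It is given by its moments: by the substitution
`t = x²`, `u(x^{2k})` and `u(x^{2k+1})` are the integrals of `(c - 1) t^k` and of `(c - t) t^k`
against `(t - 1)^{(α-1)/2} (c² - t)^{(β-1)/2}` from `1` to `c²`. -/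
def uFun (α β c : ℂ) : ℂ[X] →ₗ[ℂ] ℂ :=
  (Polynomial.basisMonomials ℂ).constr ℂ fun n =>
    if Even n then (c - 1) * betaMoment α β c (n / 2)
    else c * betaMoment α β c (n / 2) - betaMoment α β c (n / 2 + 1)

/-- `⟨u₁, f⟩ = ⟨u(-α, β, -c), f(-x)⟩`. -/
def uFun₁ (α β c : ℂ) : ℂ[X] →ₗ[ℂ] ℂ := uFun (-α) β (-c) ∘ₗ reflectX

/-- `⟨u₂, f⟩ = ⟨u(α, -β, -c), f(x)⟩`. -/
def uFun₂ (α β c : ℂ) : ℂ[X] →ₗ[ℂ] ℂ := uFun α (-β) (-c)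

/-- The shifted factorial `(a)_n`. -/
def poch (a : ℂ) (n : ℕ) : ℂ := (ascPochhammer ℂ n).eval a

/-- The closed form of `⟨u, Q_n Q_n⟩ / ⟨u, 1⟩`. -/
def normRatio (α β c : ℂ) (n : ℕ) : ℂ :=
  if Even n then
    (c ^ 2 - 1) ^ n * ((n / 2).factorial : ℂ) *
        (poch ((α + 1) / 2) (n / 2) * poch ((β + 1) / 2) (n / 2)) /
      (poch ((α + β) / 2 + 1) n * poch ((α + β + n) / 2 + 1) (n / 2))
  else
    (c - 1) ^ (n - 1) * (c + 1) ^ (n + 1) * (((n - 1) / 2).factorial : ℂ) *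
        (poch ((α + 1) / 2) ((n + 1) / 2) * poch ((β + 1) / 2) ((n + 1) / 2)) /
      (poch ((α + β) / 2 + 1) n * poch ((α + β + n + 1) / 2) ((n + 1) / 2))

/-- The closed form `h_n(α, β, c)` of the norm `⟨u, Q_n Q_n⟩`. -/
def hNorm (α β c : ℂ) (n : ℕ) : ℂ := uFun α β c 1 * normRatio α β c n

/-- `ℓ` is a discrete moment functional supported at the zeros of `P`: a linear combination of the
functionals `f ↦ f^{(j)}(z)`, with `z` a zero of `P` and `j` less than its multiplicity. -/
def IsDiscreteAtZeros (P : ℂ[X]) (ℓ : ℂ[X] →ₗ[ℂ] ℂ) : Prop :=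
  ∃ A : ℂ → ℕ → ℂ, ∀ f : ℂ[X],
    ℓ f = ∑ z ∈ P.roots.toFinset, ∑ j ∈ Finset.range (P.rootMultiplicity z),
      A z j * (Polynomial.derivative^[j] f).eval z

/-- The bilinear form `⟨p, q⟩ = ℓ(p q) + lam · v((T p)(T q))`. -/
def sobolevForm (ℓ : ℂ[X] →ₗ[ℂ] ℂ) (lam : ℂ) (v : ℂ[X] →ₗ[ℂ] ℂ) (T : ℂ[X] →ₗ[ℂ] ℂ[X])
    (p q : ℂ[X]) : ℂ :=
  ℓ (p * q) + lam * v (T p * T q)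

end BigJacobi

end

open BigJacobi

/-!
Put `a = (α + 1) / 2`, `b = (β + 1) / 2` and `σ = a + b`. The whole argument rests on a *quadratic
decomposition* of the big `-1` Jacobi polynomials. Let `F_n` and `G_n` be the monic Jacobi
polynomials in `x²` on the segment from `1` to `c²` that belong to the weights
`(x² - 1)^{a-1} (c² - x²)^b` and `(x² - 1)^a (c² - x²)^b`. They satisfy two contiguous relations,
`F_n = G_n + μ_n G_{n-1}` and `(x² - 1) G_n = F_{n+1} + λ_n F_n`, and comparing coefficients in the
three-term recurrence gives
`Q_{2n} = F_n + κ'_n (x - 1) G_{n-1}` and `Q_{2n+1} = (x - 1) G_n + κ_n F_n`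
(`Q_quadratic_decomposition`). The identity only needs `σ + k ≠ 0`, so it persists at `α = -2N-1`,
that is `a = -N`, where `κ_N = 0` and `G_N = (x² - 1)^N`; this identifies `Q_{2N+1}`. For
`β = -2N-1` one uses that the recurrence coefficients are unchanged when `α` and `β` are exchanged
and the pair of nodes `(c, 1)` is replaced by `(-1, -c)`.

*Orthogonality for nondegenerate parameters.* On `(x + c) p(x²)` the weight functional is the Jacobi
functional to which `F_n` belongs, and on `(x + c)(x - 1) p(x²)` it is zero. By the decomposition
it annihilates `(x + c) Q_n` for `n ≥ 2`, so by the recurrence and an explicit check for `n = 1, 2`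
it annihilates `Q_n` for `n ≥ 1` (`uFun_Q`). This is all that orthogonality and
`h_n = u_n h_{n-1}` require (`favard_orthogonal`, `favard_norm_succ`); the closed form of the norms
satisfies the same recursion (`normRatio_succ`).

*Degenerate parameters.* Here `u_n` vanishes exactly at `n = 2N + 1`. The functional
`Q_n ↦ δ_{n0}` then vanishes on the ideal generated by `Q_{2N+1}`, and is therefore a combination of
Hermite evaluations at the zeros of `Q_{2N+1}` (`isDiscreteAtZeros_of_dvd`). It accounts for the
indices `n ≤ 2N`. The operator `τ^{2N+1}` kills these indices and sends the others to the
nondegenerate family with parameter `2N + 1`, so the second term of the Sobolev form accounts for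
them (`sobolevForm_favard`). The limit of `h_{2N+1}` exists since the simple pole of the Gamma
factor meets a simple zero of a Pochhammer symbol, and the further limits follow from
`h_n = u_n h_{n-1}` and the shift identity `uCoeff_shift`.

*Weight integrals.* Euler's Beta integral gives the moments as integrals in `s ∈ [0, 1]` with
`x² = 1 + (c² - 1) s`; adding the contributions of the two square roots turns the weight into the
Jacobi weight (`uFun_eq_curve_integral`), and for real `c` the substitution
`x = √(1 + (c² - 1) s)` yields the integrals over the real line (`uFun_eq_real_integral`).
-/

open Polynomial Filter Topology MeasureTheory

namespace BigJacobi

/-! ### Contiguous relations for Jacobi polynomials -/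

theorem poch_zero (a : ℂ) : poch a 0 = 1 := by simp [poch]

theorem poch_succ (a : ℂ) (n : ℕ) : poch a (n + 1) = poch a n * (a + n) := by
  simp [poch, ascPochhammer_succ_eval]

theorem poch_succ_left (a : ℂ) (n : ℕ) : poch a (n + 1) = a * poch (a + 1) n := by
  simp [poch, ascPochhammer_succ_left, eval_comp]

theorem poch_ne_zero {a : ℂ} {n : ℕ} (h : ∀ k : ℕ, k < n → a + k ≠ 0) : poch a n ≠ 0 := by
  induction n with
  | zero => simp [poch_zero]
  | succ n ih =>
    rw [poch_succ]
    exact mul_ne_zero (ih fun k hk => h k (by omega)) (h n (by omega))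

theorem poch_eq_zero {a : ℂ} {n k : ℕ} (hk : k < n) (h : a + k = 0) : poch a n = 0 := by
  induction n with
  | zero => omega
  | succ n ih =>
    rw [poch_succ]
    rcases Nat.lt_succ_iff_lt_or_eq.1 hk with hk | rfl
    · rw [ih hk, zero_mul]
    · rw [h, mul_zero]

/-- The coefficient of `y ^ j` in the monic Jacobi polynomial of degree `n` in `y` on the segment
from `0` to `e`, for the weight `y ^ (a - 1) * (e - y) ^ (σ - a)`. The denominator is nonzero as
soon as `σ + k ≠ 0` for all natural `k`, so negative integers `a` are allowed. -/
noncomputable def jacobiCoeff (a σ e : ℂ) (n j : ℕ) : ℂ :=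
  (-e) ^ (n - j) * n.choose j * poch (a + j) (n - j) / poch (σ + n + j) (n - j)

/-- The monic Jacobi polynomial with coefficients `jacobiCoeff`, at `y = x ^ 2 - d ^ 2`, as a
polynomial in `x`. -/
noncomputable def shiftedJacobi (d e a σ : ℂ) (n : ℕ) : ℂ[X] :=
  ∑ j ∈ Finset.range (n + 1), C (jacobiCoeff a σ e n j) * (X ^ 2 - C (d ^ 2)) ^ j

/-- The coefficient in `(x² - d²) G_n = F_{n+1} + λ_n F_n`, where `F` and `G` are the families
`shiftedJacobi` with parameters `(a, σ)` and `(a + 1, σ + 1)`. -/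
noncomputable def lamCoeff (a σ e : ℂ) (n : ℕ) : ℂ :=
  e * (a + n) * (σ + n) / ((σ + 2 * n) * (σ + 2 * n + 1))

/-- The coefficient in `F_n = G_n + μ_n G_{n-1}`, with `F` and `G` as in `lamCoeff`. -/
noncomputable def muCoeff (a σ e : ℂ) (n : ℕ) : ℂ :=
  n * e * (σ - a + n) / ((σ + 2 * n - 1) * (σ + 2 * n))

theorem jacobiCoeff_self (a σ e : ℂ) (n : ℕ) : jacobiCoeff a σ e n n = 1 := by
  simp [jacobiCoeff, poch_zero]

theorem choose_succ_left_mul (j k : ℕ) :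
    ((j + k + 1).choose j : ℂ) * (k + 1) = (j + k).choose j * (j + k + 1) := by
  have h := Nat.choose_mul_succ_eq (j + k) j
  have h2 : j + k + 1 - j = k + 1 := by omega
  rw [h2] at h
  exact_mod_cast h.symm

theorem jacobiCoeff_eq_add (a σ e : ℂ) (hσ : ∀ k : ℕ, σ + k ≠ 0) (j k : ℕ) :
    jacobiCoeff a σ e (j + k + 1) j = jacobiCoeff (a + 1) (σ + 1) e (j + k + 1) j +
      muCoeff a σ e (j + k + 1) * jacobiCoeff (a + 1) (σ + 1) e (j + k) j := by
  -- in terms of `s = σ + 2j + 2k` every denominator is `s` or `s - k` plus a constant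
  obtain ⟨s, rfl⟩ : ∃ s, σ = s - 2 * j - 2 * k := ⟨σ + 2 * j + 2 * k, by ring⟩
  have e1 : j + k + 1 - j = k + 1 := by omega
  have e2 : j + k - j = k := by omega
  have hb := choose_succ_left_mul j k
  have hk : (k : ℂ) + 1 ≠ 0 := by exact_mod_cast Nat.succ_ne_zero k
  have hb' : ((j + k + 1).choose j : ℂ) = (j + k).choose j * (j + k + 1) / (k + 1) := by
    rw [eq_div_iff hk, hb]
  have hD : poch (s - k + 1) k ≠ 0 := poch_ne_zero fun i _ => by
    have := hσ (2 * j + k + 1 + i); push_cast at this; convert this using 1; ring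
  have n1 : s - k + 1 ≠ 0 := by
    have := hσ (2 * j + k + 1); push_cast at this; convert this using 1; ring
  have n2 : s + 1 ≠ 0 := by
    have := hσ (2 * j + 2 * k + 1); push_cast at this; convert this using 1; ring
  have n3 : s + 2 ≠ 0 := by
    have := hσ (2 * j + 2 * k + 2); push_cast at this; convert this using 1; ring
  have p1 : poch (s - k + 1) (k + 1) =
      poch (s - k + 1) k * (s + 1) := by rw [poch_succ]; ring
  have p2 : poch (s - k + 2) (k + 1) =
      poch (s - k + 1) k * (s + 1) * (s + 2)
        / (s - k + 1) := by
    rw [eq_div_iff n1]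
    have h1 := poch_succ_left (s - k + 1) (k + 1)
    rw [poch_succ, poch_succ] at h1
    have h2 : s - k + 1 + 1 = s - k + 2 := by ring
    rw [h2] at h1
    push_cast at h1
    linear_combination -h1
  unfold jacobiCoeff muCoeff
  rw [e1, e2, hb', poch_succ_left (a + j) k, poch_succ (a + 1 + j) k]
  push_cast
  have q1 : s - 2 * j - 2 * k + (j + k + 1) + j = s - k + 1 := by ring
  have q2 : s - 2 * j - 2 * k + 1 + (j + k + 1) + j = s - k + 2 := by ring
  have q3 : s - 2 * j - 2 * k + 1 + (j + k) + j = s - k + 1 := by ring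
  have q4 : a + j + 1 = a + 1 + j := by ring
  have q5 : s - 2 * j - 2 * k + 2 * (j + k + 1) - 1 = s + 1 := by ring
  have q6 : s - 2 * j - 2 * k + 2 * (j + k + 1) = s + 2 := by ring
  rw [q1, q2, q3, q4, q5, q6, p1, p2]
  generalize poch (s - k + 1) k = D at *
  generalize poch (a + 1 + j) k = A at *
  field_simp
  ring

theorem jacobiCoeff_shift (a σ e : ℂ) (hσ : ∀ k : ℕ, σ + k ≠ 0) (j k : ℕ) :
    jacobiCoeff (a + 1) (σ + 1) e (j + k + 1) j = jacobiCoeff a σ e (j + k + 2) (j + 1) +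
      lamCoeff a σ e (j + k + 1) * jacobiCoeff a σ e (j + k + 1) (j + 1) := by
  -- in terms of `s = σ + 2j + 2k` every denominator is `s` or `s - k` plus a constant
  obtain ⟨s, rfl⟩ : ∃ s, σ = s - 2 * j - 2 * k := ⟨σ + 2 * j + 2 * k, by ring⟩
  have e1 : j + k + 1 - j = k + 1 := by omega
  have e2 : j + k + 2 - (j + 1) = k + 1 := by omega
  have e3 : j + k + 1 - (j + 1) = k := by omega
  have hj : (j : ℂ) + 1 ≠ 0 := by exact_mod_cast Nat.succ_ne_zero j
  have hk : (k : ℂ) + 1 ≠ 0 := by exact_mod_cast Nat.succ_ne_zero k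
  have b1 : ((j + k + 1).choose j : ℂ) = (j + k + 1).choose (j + 1) * (j + 1) / (k + 1) := by
    rw [eq_div_iff hk]
    have h := Nat.choose_succ_right_eq (j + k + 1) j
    rw [e1] at h
    exact_mod_cast h.symm
  have b2 : ((j + k + 2).choose (j + 1) : ℂ) =
      (j + k + 1).choose (j + 1) * (j + k + 2) / (k + 1) := by
    rw [eq_div_iff hk]
    have h := choose_succ_left_mul (j + 1) k
    have h3 : j + 1 + k = j + k + 1 := by omega
    rw [h3] at h
    push_cast at h
    linear_combination h
  have hD : poch (s - k + 2) k ≠ 0 := poch_ne_zero fun i _ => by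
    have := hσ (2 * j + k + 2 + i); push_cast at this; convert this using 1; ring
  have n1 : s - k + 2 ≠ 0 := by
    have := hσ (2 * j + k + 2); push_cast at this; convert this using 1; ring
  have n2 : s + 2 ≠ 0 := by
    have := hσ (2 * j + 2 * k + 2); push_cast at this; convert this using 1; ring
  have n3 : s + 3 ≠ 0 := by
    have := hσ (2 * j + 2 * k + 3); push_cast at this; convert this using 1; ring
  have p1 : poch (s - k + 2) (k + 1) =
      poch (s - k + 2) k * (s + 2) := by rw [poch_succ]; ring
  have p2 : poch (s - k + 3) (k + 1) =
      poch (s - k + 2) k * (s + 2) * (s + 3)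
        / (s - k + 2) := by
    rw [eq_div_iff n1]
    have h1 := poch_succ_left (s - k + 2) (k + 1)
    rw [poch_succ, poch_succ] at h1
    have h2 : s - k + 2 + 1 = s - k + 3 := by ring
    rw [h2] at h1
    push_cast at h1
    linear_combination -h1
  unfold jacobiCoeff lamCoeff
  rw [e1, e2, e3, b1, b2]
  push_cast
  have q1 : s - 2 * j - 2 * k + (j + k + 2) + (j + 1) = s - k + 3 := by ring
  have q2 : s - 2 * j - 2 * k + 1 + (j + k + 1) + j = s - k + 2 := by ring
  have q3 : s - 2 * j - 2 * k + (j + k + 1) + (j + 1) = s - k + 2 := by ring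
  have q4 : a + (j + 1) = a + 1 + j := by ring
  have q6 : s - 2 * j - 2 * k + 2 * (j + k + 1) = s + 2 := by ring
  have q7 : s + 2 + 1 = s + 3 := by ring
  rw [q1, q2, q3, q4, q6, q7, p1, p2, poch_succ (a + 1 + j) k]
  generalize poch (s - k + 2) k = D at *
  generalize poch (a + 1 + j) k = A at *
  field_simp
  ring

theorem jacobiCoeff_zero_rec (a σ e : ℂ) (hσ : ∀ k : ℕ, σ + k ≠ 0) (n : ℕ) :
    jacobiCoeff a σ e (n + 1) 0 + lamCoeff a σ e n * jacobiCoeff a σ e n 0 = 0 := by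
  have hD : poch (σ + n) n ≠ 0 := poch_ne_zero fun i _ => by
    have := hσ (n + i); push_cast at this; convert this using 1; ring
  have n1 : σ + n ≠ 0 := hσ n
  have n2 : σ + 2 * n ≠ 0 := by
    have := hσ (2 * n); push_cast at this; convert this using 1
  have n3 : σ + 2 * n + 1 ≠ 0 := by
    have := hσ (2 * n + 1); push_cast at this; convert this using 1; ring
  have p2 : poch (σ + n + 1) (n + 1) =
      poch (σ + n) n * (σ + 2 * n) * (σ + 2 * n + 1) / (σ + n) := by
    rw [eq_div_iff n1]
    have h1 := poch_succ_left (σ + n) (n + 1)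
    rw [poch_succ, poch_succ] at h1
    push_cast at h1
    linear_combination -h1
  unfold jacobiCoeff lamCoeff
  simp only [Nat.sub_zero, Nat.choose_zero_right, Nat.cast_zero, add_zero, Nat.cast_one,
    Nat.cast_add]
  have q1 : σ + (n + 1 : ℂ) = σ + n + 1 := by ring
  rw [q1, p2, poch_succ a n]
  generalize poch (σ + n) n = D at *
  field_simp
  ring

theorem shiftedJacobi_eq_add (d e a σ : ℂ) (hσ : ∀ k : ℕ, σ + k ≠ 0) (n : ℕ) :
    shiftedJacobi d e a σ (n + 1) = shiftedJacobi d e (a + 1) (σ + 1) (n + 1) +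
      C (muCoeff a σ e (n + 1)) * shiftedJacobi d e (a + 1) (σ + 1) n := by
  unfold shiftedJacobi
  rw [Finset.sum_range_succ, Finset.sum_range_succ _ (n + 1), jacobiCoeff_self, jacobiCoeff_self,
    Finset.mul_sum, add_right_comm, ← Finset.sum_add_distrib]
  congr 1
  refine Finset.sum_congr rfl fun j hj => ?_
  obtain ⟨k, rfl⟩ := Nat.exists_eq_add_of_le (Nat.lt_succ_iff.1 (Finset.mem_range.1 hj))
  rw [jacobiCoeff_eq_add a σ e hσ j k, C_add, C_mul]
  ring

theorem mul_shiftedJacobi (d e a σ : ℂ) (hσ : ∀ k : ℕ, σ + k ≠ 0) (n : ℕ) :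
    (X ^ 2 - C (d ^ 2)) * shiftedJacobi d e (a + 1) (σ + 1) n =
      shiftedJacobi d e a σ (n + 1) + C (lamCoeff a σ e n) * shiftedJacobi d e a σ n := by
  have h0 := congrArg (C : ℂ → ℂ[X]) (jacobiCoeff_zero_rec a σ e hσ n)
  rw [C_add, C_mul, C_0] at h0
  unfold shiftedJacobi
  rw [Finset.sum_range_succ' _ (n + 1),
    Finset.sum_range_succ (fun j => C (jacobiCoeff (a + 1) (σ + 1) e n j) * _),
    Finset.sum_range_succ (fun j => C (jacobiCoeff a σ e (n + 1) (j + 1)) * _),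
    Finset.sum_range_succ' (fun j => C (jacobiCoeff a σ e n j) * _),
    jacobiCoeff_self, jacobiCoeff_self, mul_add, mul_add, Finset.mul_sum, Finset.mul_sum]
  have hs : ∑ i ∈ Finset.range n, (X ^ 2 - C (d ^ 2)) *
        (C (jacobiCoeff (a + 1) (σ + 1) e n i) * (X ^ 2 - C (d ^ 2)) ^ i) =
      ∑ i ∈ Finset.range n, C (jacobiCoeff a σ e (n + 1) (i + 1)) *
        (X ^ 2 - C (d ^ 2)) ^ (i + 1) +
      ∑ i ∈ Finset.range n, C (lamCoeff a σ e n) *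
        (C (jacobiCoeff a σ e n (i + 1)) * (X ^ 2 - C (d ^ 2)) ^ (i + 1)) := by
    rw [← Finset.sum_add_distrib]
    refine Finset.sum_congr rfl fun j hj => ?_
    obtain ⟨k, rfl⟩ := Nat.exists_eq_add_of_lt (Finset.mem_range.1 hj)
    rw [jacobiCoeff_shift a σ e hσ j k, C_add, C_mul]
    ring
  rw [hs]
  linear_combination -h0

theorem shiftedJacobi_zero (d e a σ : ℂ) : shiftedJacobi d e a σ 0 = 1 := by
  simp [shiftedJacobi, jacobiCoeff_self]

/-- When `a = -N`, the Jacobi polynomial of degree `N` with the next parameter `a + 1` is a pure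
power: every lower coefficient contains the factor `0` in its Pochhammer symbol. -/
theorem shiftedJacobi_degenerate (d e σ : ℂ) (N : ℕ) :
    shiftedJacobi d e (-N + 1) σ N = (X ^ 2 - C (d ^ 2)) ^ N := by
  unfold shiftedJacobi
  rw [Finset.sum_range_succ, jacobiCoeff_self, Finset.sum_eq_zero, zero_add, C_1, one_mul]
  intro j hj
  obtain ⟨k, rfl⟩ := Nat.exists_eq_add_of_lt (Finset.mem_range.1 hj)
  have e1 : j + k + 1 - j = k + 1 := by omega
  have : poch (-((j + k + 1 : ℕ) : ℂ) + 1 + j) (j + k + 1 - j) = 0 :=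
    poch_eq_zero (k := k) (by omega) (by push_cast; ring)
  rw [jacobiCoeff, this]
  simp

/-- Quadratic decomposition of `Q` from contiguous relations: if two sequences `F`, `G` satisfy
`F_{n+1} = G_{n+1} + μ_{n+1} G_n` and `(x² - d²) G_n = F_{n+1} + λ_n F_n`, and the recurrence
coefficients of `Q` are matched to `λ, μ, κ, κ'` by comparing coefficients of
`F_n`, `(x - d) G_n` and their neighbours, then `Q_{2n+1}` and `Q_{2n+2}` are the stated
combinations. -/
theorem Q_quadratic_decomposition_of_coeff {α β c d : ℂ} {F G : ℕ → ℂ[X]} {lam mu κ κ' : ℕ → ℂ}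
    (hF0 : F 0 = 1) (hG0 : G 0 = 1)
    (hFG : ∀ n, F (n + 1) = G (n + 1) + C (mu (n + 1)) * G n)
    (hGF : ∀ n, (X ^ 2 - C (d ^ 2)) * G n = F (n + 1) + C (lam n) * F n)
    (hb0 : bCoeff α β c 0 = d - κ 0)
    (hb : ∀ n, bCoeff α β c (2 * n + 2) = d + κ' (n + 1) - κ (n + 1))
    (hb' : ∀ n, bCoeff α β c (2 * n + 1) = -d + κ n - κ' (n + 1))
    (hu : ∀ n, uCoeff α β c (2 * n + 2) =
      mu (n + 1) - d * κ' (n + 1) - bCoeff α β c (2 * n + 2) * κ' (n + 1))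
    (hu' : ∀ n, uCoeff α β c (2 * n + 1) = lam n + d * κ n - bCoeff α β c (2 * n + 1) * κ n)
    (hl : ∀ n, κ' (n + 1) * lam n = uCoeff α β c (2 * n + 2) * κ n)
    (hm : ∀ n, κ (n + 1) * mu (n + 1) = uCoeff α β c (2 * n + 3) * κ' (n + 1)) (n : ℕ) :
    Q α β c (2 * n + 1) = (X - C d) * G n + C (κ n) * F n ∧
      Q α β c (2 * n + 2) = F (n + 1) + C (κ' (n + 1)) * ((X - C d) * G n) := by
  have hF' : ∀ n, X ^ 2 * G n = C d ^ 2 * G n + F (n + 1) + C (lam n) * F n := fun n => by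
    have := hGF n
    rw [C_pow] at this
    linear_combination this
  have even_step : ∀ n, Q α β c (2 * n + 1) = (X - C d) * G n + C (κ n) * F n →
      Q α β c (2 * n + 2) = F (n + 1) + C (κ' (n + 1)) * ((X - C d) * G n) →
      Q α β c (2 * n + 3) = (X - C d) * G (n + 1) + C (κ (n + 1)) * F (n + 1) := by
    intro n h1 h2
    have eb := congrArg (C : ℂ → ℂ[X]) (hb n)
    have eu := congrArg (C : ℂ → ℂ[X]) (hu n)
    have el := congrArg (C : ℂ → ℂ[X]) (hl n)
    simp only [C_add, C_sub, C_mul] at eb eu el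
    rw [Q, h1, h2]
    linear_combination (C (κ' (n + 1))) * hF' n - F (n + 1) * eb
      - ((X - C d) * G n) * eu + F n * el + (X - C d) * hFG n
  have odd_step : ∀ n, Q α β c (2 * n + 2) = F (n + 1) + C (κ' (n + 1)) * ((X - C d) * G n) →
      Q α β c (2 * n + 3) = (X - C d) * G (n + 1) + C (κ (n + 1)) * F (n + 1) →
      Q α β c (2 * n + 4) = F (n + 2) + C (κ' (n + 2)) * ((X - C d) * G (n + 1)) := by
    intro n h1 h2
    have eb := congrArg (C : ℂ → ℂ[X]) (hb' (n + 1))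
    have eu := congrArg (C : ℂ → ℂ[X]) (hu' (n + 1))
    have em := congrArg (C : ℂ → ℂ[X]) (hm n)
    have i1 : 2 * (n + 1) + 1 = 2 * n + 3 := by ring
    rw [i1] at eb eu
    simp only [C_add, C_sub, C_mul, C_neg] at eb eu em
    rw [Q, h1, h2]
    linear_combination hF' (n + 1) - F (n + 1) * eu - (X - C d) * G (n + 1) * eb
       + C (κ (n + 1)) * (X - C d) * hFG n + (X - C d) * G n * em
  induction n with
  | zero =>
    have h1 : Q α β c (2 * 0 + 1) = (X - C d) * G 0 + C (κ 0) * F 0 := by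
      rw [hF0, hG0, Q, hb0, C_sub]; ring
    refine ⟨h1, ?_⟩
    have eb := congrArg (C : ℂ → ℂ[X]) (hb' 0)
    have eu := congrArg (C : ℂ → ℂ[X]) (hu' 0)
    simp only [C_add, C_sub, C_mul, C_neg, mul_zero, zero_add] at eb eu
    have h := hF' 0
    simp only [mul_zero, zero_add] at h1 h ⊢
    rw [Q, h1, zero_add, eu, Q]
    rw [hF0, hG0] at *
    linear_combination h - (X - C d) * eb
  | succ n ih =>
    have h3 := even_step n ih.1 ih.2
    exact ⟨h3, odd_step n ih.2 h3⟩

/-! ### Quadratic decomposition of the big `-1` Jacobi polynomials -/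

section Coefficients

variable {α β : ℂ} (hS : ∀ n : ℕ, 1 ≤ n → α + β + 2 * n ≠ 0)
include hS

theorem halfSum_add_ne_zero (k : ℕ) : (α + 1) / 2 + (β + 1) / 2 + k ≠ 0 := by
  have := hS (k + 1) (by omega)
  push_cast at this
  intro h
  apply this
  linear_combination 2 * h

end Coefficients

theorem bCoeff_zero (c a b : ℂ) :
    bCoeff (2 * a - 1) (2 * b - 1) c 0 = -c + (c + 1) * b / (a + b) := by
  have h : (2 * a - 1 + (2 * b - 1) + 2 * (0 : ℕ) + 2 : ℂ) = 2 * (a + b) := by push_cast; ring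
  have h1 : (c + 1) * (2 * b - 1 + (0 : ℕ) + 1 : ℂ) = 2 * ((c + 1) * b) := by push_cast; ring
  rw [bCoeff, if_pos (by decide), h, h1, mul_div_mul_left _ _ two_ne_zero]
  simp

theorem bCoeff_even (c a b : ℂ) (n : ℕ) :
    bCoeff (2 * a - 1) (2 * b - 1) c (2 * n + 2) =
      -c + (c - 1) * (n + 1) / (a + b + 2 * n + 1) +
        (c + 1) * (b + n + 1) / (a + b + 2 * n + 2) := by
  have e1 : (c - 1) * ((2 * n + 2 : ℕ) : ℂ) = 2 * ((c - 1) * (n + 1)) := by push_cast; ring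
  have e2 : (2 * a - 1 + (2 * b - 1) + 2 * (2 * n + 2 : ℕ) : ℂ) = 2 * (a + b + 2 * n + 1) := by
    push_cast; ring
  have e3 : (c + 1) * (2 * b - 1 + (2 * n + 2 : ℕ) + 1 : ℂ) = 2 * ((c + 1) * (b + n + 1)) := by
    push_cast; ring
  have e4 : 2 * (a + b + 2 * n + 1) + 2 = 2 * (a + b + 2 * n + 2) := by ring
  rw [bCoeff, if_pos ⟨n + 1, by ring⟩, e1, e2, e3, e4, mul_div_mul_left _ _ two_ne_zero,
    mul_div_mul_left _ _ two_ne_zero]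

theorem bCoeff_odd (c a b : ℂ) (n : ℕ) :
    bCoeff (2 * a - 1) (2 * b - 1) c (2 * n + 1) =
      c - (c - 1) * (n + 1) / (a + b + 2 * n + 1) - (c + 1) * (b + n) / (a + b + 2 * n) := by
  have e1 : (c - 1) * ((2 * n + 1 : ℕ) + 1 : ℂ) = 2 * ((c - 1) * (n + 1)) := by push_cast; ring
  have e2 : (2 * a - 1 + (2 * b - 1) + 2 * (2 * n + 1 : ℕ) : ℂ) = 2 * (a + b + 2 * n) := by
    push_cast; ring
  have e3 : (c + 1) * (2 * b - 1 + (2 * n + 1 : ℕ) : ℂ) = 2 * ((c + 1) * (b + n)) := by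
    push_cast; ring
  have e4 : 2 * (a + b + 2 * n) + 2 = 2 * (a + b + 2 * n + 1) := by ring
  rw [bCoeff, if_neg (by simp), e1, e2, e3, e4, mul_div_mul_left _ _ two_ne_zero,
    mul_div_mul_left _ _ two_ne_zero]

theorem uCoeff_even (c a b : ℂ) (n : ℕ) :
    uCoeff (2 * a - 1) (2 * b - 1) c (2 * n + 2) =
      (c - 1) ^ 2 * (n + 1) * (a + b + n) / (a + b + 2 * n + 1) ^ 2 := by
  have e1 : (c - 1) ^ 2 * ((2 * n + 2 : ℕ) : ℂ) * (2 * a - 1 + (2 * b - 1) + (2 * n + 2 : ℕ)) =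
      2 ^ 2 * ((c - 1) ^ 2 * (n + 1) * (a + b + n)) := by push_cast; ring
  have e2 : (2 * a - 1 + (2 * b - 1) + 2 * (2 * n + 2 : ℕ) : ℂ) ^ 2 =
      2 ^ 2 * (a + b + 2 * n + 1) ^ 2 := by push_cast; ring
  rw [uCoeff, if_pos ⟨n + 1, by ring⟩, e1, e2, mul_div_mul_left _ _ (by norm_num)]

theorem uCoeff_odd (c a b : ℂ) (n : ℕ) :
    uCoeff (2 * a - 1) (2 * b - 1) c (2 * n + 1) =
      (c + 1) ^ 2 * (a + n) * (b + n) / (a + b + 2 * n) ^ 2 := by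
  have e1 : (c + 1) ^ 2 * (2 * a - 1 + (2 * n + 1 : ℕ)) * (2 * b - 1 + (2 * n + 1 : ℕ)) =
      2 ^ 2 * ((c + 1) ^ 2 * (a + n) * (b + n)) := by push_cast; ring
  have e2 : (2 * a - 1 + (2 * b - 1) + 2 * (2 * n + 1 : ℕ) : ℂ) ^ 2 =
      2 ^ 2 * (a + b + 2 * n) ^ 2 := by push_cast; ring
  rw [uCoeff, if_neg (by simp), e1, e2, mul_div_mul_left _ _ (by norm_num)]

/-- The coefficient `κ_n` in `Q_{2n+1} = (x - d) G_n + κ_n F_n`. -/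
noncomputable def kappaOdd (c d a σ : ℂ) (n : ℕ) : ℂ := (c + d) * (a + n) / (σ + 2 * n)

/-- The coefficient `κ'_n` in `Q_{2n} = F_n + κ'_n (x - d) G_{n-1}`. -/
noncomputable def kappaEven (c d σ : ℂ) (n : ℕ) : ℂ := n * (c - d) / (σ + 2 * n - 1)

/-- The quadratic decomposition in a form that is homogeneous in the pair `(p, d)`. The big `-1`
Jacobi coefficients have the required shape for `(p, d) = (c, 1)` and, after exchanging `a` and
`b`, also for `(p, d) = (-1, -c)`. -/
theorem Q_quadratic_decomposition_of_eq {α β c : ℂ} (p a b d : ℂ) (hσ : ∀ k : ℕ, a + b + k ≠ 0)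
    (hb0 : bCoeff α β c 0 = -p + (p + d) * b / (a + b))
    (hb : ∀ n : ℕ, bCoeff α β c (2 * n + 2) =
      -p + (p - d) * (n + 1) / (a + b + 2 * n + 1) + (p + d) * (b + n + 1) / (a + b + 2 * n + 2))
    (hb' : ∀ n : ℕ, bCoeff α β c (2 * n + 1) =
      p - (p - d) * (n + 1) / (a + b + 2 * n + 1) - (p + d) * (b + n) / (a + b + 2 * n))
    (hu : ∀ n : ℕ, uCoeff α β c (2 * n + 2) =
      (p - d) ^ 2 * (n + 1) * (a + b + n) / (a + b + 2 * n + 1) ^ 2)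
    (hu' : ∀ n : ℕ, uCoeff α β c (2 * n + 1) =
      (p + d) ^ 2 * (a + n) * (b + n) / (a + b + 2 * n) ^ 2) (n : ℕ) :
    Q α β c (2 * n + 1) =
        (X - C d) * shiftedJacobi d (p ^ 2 - d ^ 2) (a + 1) (a + b + 1) n +
          C (kappaOdd p d a (a + b) n) * shiftedJacobi d (p ^ 2 - d ^ 2) a (a + b) n ∧
      Q α β c (2 * n + 2) =
        shiftedJacobi d (p ^ 2 - d ^ 2) a (a + b) (n + 1) +
          C (kappaEven p d (a + b) (n + 1)) *
            ((X - C d) * shiftedJacobi d (p ^ 2 - d ^ 2) (a + 1) (a + b + 1) n) := by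
  refine Q_quadratic_decomposition_of_coeff (lam := lamCoeff a (a + b) (p ^ 2 - d ^ 2))
    (mu := muCoeff a (a + b) (p ^ 2 - d ^ 2)) (F := shiftedJacobi d (p ^ 2 - d ^ 2) a (a + b))
    (G := shiftedJacobi d (p ^ 2 - d ^ 2) (a + 1) (a + b + 1))
    (κ := kappaOdd p d a (a + b)) (κ' := kappaEven p d (a + b))
    (shiftedJacobi_zero ..) (shiftedJacobi_zero ..)
    (shiftedJacobi_eq_add _ _ _ _ hσ) (mul_shiftedJacobi _ _ _ _ hσ) ?_ ?_ ?_ ?_ ?_ ?_ ?_ n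
  · have s0 : a + b ≠ 0 := by simpa using hσ 0
    rw [hb0, kappaOdd]
    simp only [Nat.cast_zero, mul_zero, add_zero]
    field_simp
    ring
  all_goals
    intro n
    have hs : ∀ k : ℕ, a + b + 2 * n + k ≠ 0 := fun k => by
      have := hσ (2 * n + k); push_cast at this; rwa [add_assoc]
    obtain ⟨w, rfl⟩ : ∃ w, b = w - 2 * n - a := ⟨a + b + 2 * n, by ring⟩
    have j0 : a + (w - 2 * n - a) + 2 * n = w := by ring
    have j1 : a + (w - 2 * n - a) + 2 * (n + 1) = w + 2 := by ring
    have j2 : w + 2 - 1 = w + 1 := by ring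
    have t0 : w ≠ 0 := by simpa [j0] using hs 0
    have t1 : w + 1 ≠ 0 := by simpa [j0] using hs 1
    have t2 : w + 2 ≠ 0 := by simpa [j0] using hs 2
    have t3 : w + 3 ≠ 0 := by simpa [j0] using hs 3
    have i3 : 2 * n + 3 = 2 * (n + 1) + 1 := by ring
    try rw [i3]
    simp only [hb, hb', hu, hu', kappaOdd, kappaEven, lamCoeff, muCoeff, Nat.cast_add,
      Nat.cast_one, j0, j1, j2]
    field_simp
    ring

theorem Q_quadratic_decomposition (c a b : ℂ) (hσ : ∀ k : ℕ, a + b + k ≠ 0) (n : ℕ) :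
    Q (2 * a - 1) (2 * b - 1) c (2 * n + 1) =
        (X - C 1) * shiftedJacobi 1 (c ^ 2 - 1 ^ 2) (a + 1) (a + b + 1) n +
          C (kappaOdd c 1 a (a + b) n) * shiftedJacobi 1 (c ^ 2 - 1 ^ 2) a (a + b) n ∧
      Q (2 * a - 1) (2 * b - 1) c (2 * n + 2) =
        shiftedJacobi 1 (c ^ 2 - 1 ^ 2) a (a + b) (n + 1) +
          C (kappaEven c 1 (a + b) (n + 1)) *
            ((X - C 1) * shiftedJacobi 1 (c ^ 2 - 1 ^ 2) (a + 1) (a + b + 1) n) :=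
  Q_quadratic_decomposition_of_eq c a b 1 hσ (bCoeff_zero c a b) (bCoeff_even c a b)
    (bCoeff_odd c a b) (uCoeff_even c a b) (uCoeff_odd c a b) n

/-- The odd half of the decomposition around `x = -c` instead of `x = 1`. -/
theorem Q_quadratic_decomposition_swap (c a b : ℂ) (hσ : ∀ k : ℕ, a + b + k ≠ 0) (n : ℕ) :
    Q (2 * a - 1) (2 * b - 1) c (2 * n + 1) =
        (X - C (-c)) * shiftedJacobi (-c) ((-1) ^ 2 - (-c) ^ 2) (b + 1) (b + a + 1) n +
          C (kappaOdd (-1) (-c) b (b + a) n) *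
            shiftedJacobi (-c) ((-1) ^ 2 - (-c) ^ 2) b (b + a) n := by
  have hs : ∀ n k : ℕ, a + b + 2 * n + k ≠ 0 := fun n k => by
    have := hσ (2 * n + k); push_cast at this; rwa [add_assoc]
  refine (Q_quadratic_decomposition_of_eq (-1) b a (-c) (by simpa only [add_comm b a] using hσ)
    ?_ ?_ ?_ ?_ ?_ n).1
  · have := hs 0 0
    simp only [Nat.cast_zero, mul_zero, add_zero] at this
    rw [bCoeff_zero, add_comm b a]
    field_simp
    ring
  all_goals
    intro n
    have t0 := hs n 0
    have t1 := hs n 1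
    have t2 := hs n 2
    rw [Nat.cast_zero, add_zero] at t0
    rw [Nat.cast_one] at t1
    rw [Nat.cast_ofNat] at t2
    simp only [bCoeff_even, bCoeff_odd, uCoeff_even, uCoeff_odd, add_comm b a]
    obtain ⟨w, rfl⟩ : ∃ w, b = w - 2 * n - a := ⟨a + b + 2 * n, by ring⟩
    have j0 : a + (w - 2 * n - a) + 2 * n = w := by ring
    simp only [j0] at *
    field_simp
    ring

theorem Q_degenerate_alpha (N : ℕ) (β c : ℂ)
    (hS : ∀ n : ℕ, 1 ≤ n → (-2 * N - 1 : ℂ) + β + 2 * n ≠ 0) :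
    Q (-2 * N - 1) β c (2 * N + 1) = (X ^ 2 - 1) ^ N * (X - 1) := by
  have hσ := halfSum_add_ne_zero hS
  have e1 : ((-2 * N - 1 : ℂ) + 1) / 2 = -N := by ring
  rw [e1] at hσ
  have h := (Q_quadratic_decomposition c (-N) ((β + 1) / 2) hσ N).1
  have e2 : 2 * (-N : ℂ) - 1 = -2 * N - 1 := by ring
  have e3 : 2 * ((β + 1) / 2) - 1 = β := by ring
  rw [e2, e3, shiftedJacobi_degenerate, kappaOdd] at h
  rw [h]
  simp [mul_comm]

theorem Q_degenerate_beta (N : ℕ) (α c : ℂ)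
    (hS : ∀ n : ℕ, 1 ≤ n → α + (-2 * N - 1 : ℂ) + 2 * n ≠ 0) :
    Q α (-2 * N - 1) c (2 * N + 1) = (X ^ 2 - C (c ^ 2)) ^ N * (X + C c) := by
  have hσ := halfSum_add_ne_zero hS
  have e1 : ((-2 * N - 1 : ℂ) + 1) / 2 = -N := by ring
  rw [e1] at hσ
  have h := Q_quadratic_decomposition_swap c ((α + 1) / 2) (-N) hσ N
  have e2 : 2 * (-N : ℂ) - 1 = -2 * N - 1 := by ring
  have e3 : 2 * ((α + 1) / 2) - 1 = α := by ring
  rw [e2, e3, shiftedJacobi_degenerate, kappaOdd] at h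
  rw [h]
  simp [mul_comm]

theorem uCoeff_ne_zero {α β c : ℂ} (hc₁ : c ≠ 1) (hc₂ : c ≠ -1)
    (hS : ∀ n : ℕ, 1 ≤ n → α + β + 2 * n ≠ 0) {n : ℕ} (hn : 1 ≤ n)
    (hα : Odd n → α + n ≠ 0) (hβ : Odd n → β + n ≠ 0) : uCoeff α β c n ≠ 0 := by
  have hd : (α + β + 2 * n) ^ 2 ≠ 0 := pow_ne_zero _ (hS n hn)
  have h1 : (c - 1) ^ 2 ≠ 0 := pow_ne_zero _ (sub_ne_zero.2 hc₁)
  have h2 : (c + 1) ^ 2 ≠ 0 := pow_ne_zero _ (fun h => hc₂ (eq_neg_of_add_eq_zero_left h))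
  unfold uCoeff
  split_ifs with he
  · obtain ⟨k, rfl⟩ := he
    have h3 := hS k (by omega)
    have h4 : ((k + k : ℕ) : ℂ) ≠ 0 := by exact_mod_cast (by omega : k + k ≠ 0)
    have h5 : α + β + ((k + k : ℕ) : ℂ) ≠ 0 := by push_cast; rwa [← two_mul]
    exact div_ne_zero (mul_ne_zero (mul_ne_zero h1 h4) h5) hd
  · have ho := Nat.not_even_iff_odd.1 he
    exact div_ne_zero (mul_ne_zero (mul_ne_zero h2 (hα ho)) (hβ ho)) hd

theorem uCoeff_eq_zero_iff_of_alpha {β c : ℂ} (hc₁ : c ≠ 1) (hc₂ : c ≠ -1) {N : ℕ}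
    (hS : ∀ n : ℕ, 1 ≤ n → (-2 * N - 1 : ℂ) + β + 2 * n ≠ 0) {n : ℕ} (hn : 1 ≤ n) :
    uCoeff (-2 * N - 1) β c n = 0 ↔ n = 2 * N + 1 := by
  constructor
  · intro h
    by_contra hne
    refine uCoeff_ne_zero hc₁ hc₂ hS hn (fun _ h0 => hne ?_) (fun ho h0 => ?_) h
    · have : (n : ℂ) = ((2 * N + 1 : ℕ) : ℂ) := by push_cast; linear_combination h0
      exact_mod_cast this
    · obtain ⟨k, rfl⟩ := ho
      refine hS (N + k + 1) (by omega) ?_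
      push_cast at h0 ⊢
      linear_combination h0
  · rintro rfl
    rw [uCoeff, if_neg (by simp)]
    push_cast
    ring

theorem uCoeff_comm (α β c : ℂ) (n : ℕ) : uCoeff α β c n = uCoeff β α c n := by
  unfold uCoeff
  split_ifs <;> ring

/-- Past the index where `u` vanishes, the recurrence coefficients are those of the family with
parameters `(2N + 1, β, -c)`. -/
theorem uCoeff_shift (N : ℕ) (β c : ℂ) (n : ℕ) :
    uCoeff (-2 * N - 1) β c (2 * N + 1 + n) = uCoeff (2 * N + 1) β (-c) n := by
  unfold uCoeff
  rcases Nat.even_or_odd n with h | h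
  · have h' : ¬ Even (2 * N + 1 + n) := by
      rw [Nat.not_even_iff_odd]; exact Odd.add_even (by simp) h
    rw [if_pos h, if_neg h']
    push_cast
    ring_nf
  · have h' : Even (2 * N + 1 + n) := Odd.add_odd (by simp) h
    rw [if_pos h', if_neg (Nat.not_even_iff_odd.2 h)]
    push_cast
    ring_nf

/-! ### The moments of the weight functional -/

/-- The analytic continuation of `q ↦ ∫_1^{c²} q(t) (t - 1)^{(α-1)/2} (c² - t)^{(β-1)/2} dt`,
prescribed through its values on the powers of `t - 1`, which are single Beta values. -/
noncomputable def betaFun (α β c : ℂ) : ℂ[X] →ₗ[ℂ] ℂ :=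
  ((Polynomial.basisMonomials ℂ).constr ℂ fun j => (c ^ 2 - 1) ^ ((α + β) / 2) *
    ((c ^ 2 - 1) ^ j * (Complex.Gamma ((α + 1) / 2 + j) * Complex.Gamma ((β + 1) / 2) /
        Complex.Gamma ((α + 1) / 2 + (β + 1) / 2 + j)))) ∘ₗ Polynomial.taylor 1

theorem basisMonomials_constr_monomial (f : ℕ → ℂ) (n : ℕ) (w : ℂ) :
    (Polynomial.basisMonomials ℂ).constr ℂ f (monomial n w) = w * f n := by
  have h : monomial n w = w • (Polynomial.basisMonomials ℂ) n := by
    simp [smul_monomial]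
  rw [h, map_smul, Module.Basis.constr_basis, smul_eq_mul]

theorem basisMonomials_constr_X_pow (f : ℕ → ℂ) (n : ℕ) :
    (Polynomial.basisMonomials ℂ).constr ℂ f (X ^ n) = f n := by
  rw [X_pow_eq_monomial, basisMonomials_constr_monomial, one_mul]

theorem betaFun_X_sub_one_pow (α β c : ℂ) (j : ℕ) :
    betaFun α β c ((X - 1) ^ j) = (c ^ 2 - 1) ^ ((α + β) / 2) *
    ((c ^ 2 - 1) ^ j * (Complex.Gamma ((α + 1) / 2 + j) * Complex.Gamma ((β + 1) / 2) /
        Complex.Gamma ((α + 1) / 2 + (β + 1) / 2 + j))) := by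
  rw [betaFun, LinearMap.comp_apply, taylor_pow, map_sub, taylor_X, taylor_one,
    add_sub_cancel_right, basisMonomials_constr_X_pow]

theorem betaFun_X_pow (α β c : ℂ) (k : ℕ) : betaFun α β c (X ^ k) = betaMoment α β c k := by
  rw [betaFun, LinearMap.comp_apply, taylor_X_pow, C_1, add_pow, map_sum, betaMoment,
    Finset.mul_sum]
  refine Finset.sum_congr rfl fun j _ => ?_
  have : (X : ℂ[X]) ^ j * 1 ^ (k - j) * (k.choose j : ℂ[X]) = monomial j (k.choose j : ℂ) := by
    rw [← C_mul_X_pow_eq_monomial, one_pow, mul_one, mul_comm]; simp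
  rw [this, basisMonomials_constr_monomial]
  ring

theorem uFun_X_pow (α β c : ℂ) (n : ℕ) : uFun α β c (X ^ n) =
    if Even n then (c - 1) * betaMoment α β c (n / 2)
    else c * betaMoment α β c (n / 2) - betaMoment α β c (n / 2 + 1) := by
  rw [uFun, basisMonomials_constr_X_pow]

theorem uFun_even (α β c : ℂ) (p : ℂ[X]) :
    uFun α β c (p.comp (X ^ 2)) = (c - 1) * betaFun α β c p := by
  induction p using Polynomial.induction_on' with
  | add p q hp hq => rw [add_comp, map_add, map_add, hp, hq, mul_add]
  | monomial n w =>
    rw [← C_mul_X_pow_eq_monomial, ← smul_eq_C_mul, smul_comp, map_smul, map_smul, X_pow_comp,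
      ← pow_mul, uFun_X_pow, if_pos (by simp), betaFun_X_pow, Nat.mul_div_cancel_left _ two_pos,
      smul_eq_mul, smul_eq_mul]
    ring

theorem uFun_odd (α β c : ℂ) (p : ℂ[X]) :
    uFun α β c (X * p.comp (X ^ 2)) = betaFun α β c ((C c - X) * p) := by
  induction p using Polynomial.induction_on' with
  | add p q hp hq => rw [add_comp, mul_add, mul_add, map_add, map_add, hp, hq]
  | monomial n w =>
    have h1 : (2 * n + 1) / 2 = n := by omega
    have h2 : (C c - X) * X ^ n = c • X ^ n - X ^ (n + 1) := by rw [smul_eq_C_mul]; ring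
    rw [← C_mul_X_pow_eq_monomial, ← smul_eq_C_mul, smul_comp, mul_smul_comm, mul_smul_comm,
      map_smul, map_smul, X_pow_comp,
      ← pow_mul, ← pow_succ', uFun_X_pow, if_neg (by simp), h1, h2, map_sub, map_smul,
      betaFun_X_pow, betaFun_X_pow, smul_eq_mul, smul_eq_mul, smul_eq_mul]

/-- On `(x + c) p(x²)` the weight functional is integration against the Jacobi weight whose exponent
at `c²` is raised by one. -/
theorem uFun_X_add_C_mul (α β c : ℂ) (p : ℂ[X]) :
    uFun α β c ((X + C c) * p.comp (X ^ 2)) = betaFun α β c ((C (c ^ 2) - X) * p) := by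
  rw [add_mul, map_add, uFun_odd, ← smul_eq_C_mul, map_smul, uFun_even, ← smul_eq_mul (c - 1),
    ← map_smul, ← map_smul, ← map_add, smul_smul, smul_eq_C_mul]
  congr 1
  simp only [C_mul, C_sub, C_pow, C_1]
  ring

theorem uFun_X_add_C_mul_X_sub_one_mul (α β c : ℂ) (p : ℂ[X]) :
    uFun α β c ((X + C c) * ((X - C 1) * p.comp (X ^ 2))) = 0 := by
  have h : (X + C c) * ((X - C 1) * p.comp (X ^ 2)) =
      (X * p).comp (X ^ 2) + (c - 1) • (X * p.comp (X ^ 2)) - c • p.comp (X ^ 2) := by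
    simp only [smul_eq_C_mul, C_sub, C_1, mul_comp, X_comp]
    ring
  rw [h, map_sub, map_add, map_smul, map_smul, uFun_even, uFun_odd, uFun_even, smul_eq_mul,
    smul_eq_mul, sub_mul (C c), map_sub, ← smul_eq_C_mul, map_smul, smul_eq_mul]
  ring

theorem Gamma_add_nat {z : ℂ} {n : ℕ} (hz : ∀ k : ℕ, k < n → z ≠ -k) :
    Complex.Gamma (z + n) = poch z n * Complex.Gamma z := by
  induction n with
  | zero => simp [poch_zero]
  | succ n ih =>
    have hn : z + n ≠ 0 := fun h => hz n (by omega) (eq_neg_of_add_eq_zero_left h)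
    rw [Nat.cast_succ, ← add_assoc, Complex.Gamma_add_one _ hn, ih fun k hk => hz k (by omega),
      poch_succ]
    ring

/-- An `(n + 1)`-st finite difference of a polynomial of degree `n` vanishes. -/
theorem sum_alternating_choose_mul_poch (z : ℂ) (n : ℕ) :
    ∑ j ∈ Finset.range (n + 2), (-1 : ℂ) ^ (n + 1 - j) * (n + 1).choose j * poch (z + j) n = 0 := by
  have hdeg : ((ascPochhammer ℂ n).comp (X + C z)).natDegree < n + 1 := by
    rw [natDegree_comp, natDegree_X_add_C, mul_one, ascPochhammer_natDegree]
    omega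
  have h := congrFun (Polynomial.fwdDiff_iter_eq_zero_of_degree_lt hdeg) 0
  rw [fwdDiff_iter_eq_sum_shift] at h
  refine Eq.trans ?_ h
  refine Finset.sum_congr rfl fun j _ => ?_
  simp [poch, add_comm z]

section

variable {α β : ℂ} (hα : ∀ k : ℕ, α ≠ -(2 * k + 1)) (hβ : ∀ k : ℕ, β ≠ -(2 * k + 1))
  (hS : ∀ n : ℕ, 1 ≤ n → α + β + 2 * n ≠ 0)

include hα in
theorem half_ne_neg_nat (k : ℕ) : (α + 1) / 2 ≠ -k := fun h =>
  hα k (by linear_combination 2 * h)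

include hS in
theorem halfSum_ne_neg_nat (k : ℕ) : (α + 1) / 2 + (β + 1) / 2 ≠ -k := fun h =>
  halfSum_add_ne_zero hS k (by linear_combination h)

include hα hβ hS

theorem betaFun_C_sub_X_mul (c : ℂ) (j : ℕ) :
    betaFun α β c ((C (c ^ 2) - X) * (X - 1) ^ j) = (c ^ 2 - 1) ^ ((α + β) / 2) *
      ((c ^ 2 - 1) ^ (j + 1) * (Complex.Gamma ((α + 1) / 2 + j) * Complex.Gamma ((β + 1) / 2 + 1) /
        Complex.Gamma ((α + 1) / 2 + (β + 1) / 2 + 1 + j))) := by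
  have h : (C (c ^ 2) - X) * (X - 1) ^ j =
      (c ^ 2 - 1) • (X - 1 : ℂ[X]) ^ j - (X - 1) ^ (j + 1) := by
    rw [smul_eq_C_mul, C_sub, C_1]; ring
  rw [h, map_sub, map_smul, betaFun_X_sub_one_pow, betaFun_X_sub_one_pow, smul_eq_mul]
  have ha := half_ne_neg_nat hα j
  have hb := half_ne_neg_nat hβ 0
  have hs := halfSum_ne_neg_nat hS j
  have hg := Complex.Gamma_ne_zero (s := (α + 1) / 2 + (β + 1) / 2 + j) fun k hk =>
    halfSum_ne_neg_nat hS (j + k) (by push_cast; linear_combination hk)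
  generalize (c ^ 2 - 1) ^ ((α + β) / 2) = K at *
  generalize (α + 1) / 2 = a at *
  generalize (β + 1) / 2 = b at *
  have ha' : a + j ≠ 0 := fun h => ha (eq_neg_of_add_eq_zero_left h)
  have hs' : a + b + j ≠ 0 := fun h => hs (eq_neg_of_add_eq_zero_left h)
  have hb' : b ≠ 0 := by simpa using hb
  have e1 : a + (j + 1 : ℕ) = a + j + 1 := by push_cast; ring
  have e2 : a + b + (j + 1 : ℕ) = a + b + j + 1 := by push_cast; ring
  have e3 : a + b + 1 + j = a + b + j + 1 := by ring
  rw [e1, e2, e3, Complex.Gamma_add_one _ ha', Complex.Gamma_add_one _ hs',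
    Complex.Gamma_add_one _ hb']
  field_simp
  ring

/-- `F_{n+1}` is orthogonal to `1` for the raised Jacobi weight. Multiplying the coefficients by the
moments leaves, up to a common factor, an alternating binomial sum of a polynomial of degree
`n`. -/
theorem uFun_X_add_C_mul_shiftedJacobi (c : ℂ) (n : ℕ) :
    uFun α β c ((X + C c) * shiftedJacobi 1 (c ^ 2 - 1 ^ 2) ((α + 1) / 2)
      ((α + 1) / 2 + (β + 1) / 2) (n + 1)) = 0 := by
  have hcomp : shiftedJacobi 1 (c ^ 2 - 1 ^ 2) ((α + 1) / 2) ((α + 1) / 2 + (β + 1) / 2) (n + 1) =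
      (∑ j ∈ Finset.range (n + 2), jacobiCoeff ((α + 1) / 2) ((α + 1) / 2 + (β + 1) / 2)
        (c ^ 2 - 1) (n + 1) j • (X - 1 : ℂ[X]) ^ j).comp (X ^ 2) := by
    simp [shiftedJacobi, smul_eq_C_mul, mul_comp]
  rw [hcomp, uFun_X_add_C_mul, Finset.mul_sum, map_sum]
  simp only [mul_smul_comm, map_smul, betaFun_C_sub_X_mul hα hβ hS]
  have ha := half_ne_neg_nat hα
  have hs := halfSum_ne_neg_nat hS
  generalize (c ^ 2 - 1) ^ ((α + β) / 2) = K at *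
  generalize (α + 1) / 2 = a at *
  generalize (β + 1) / 2 = b at *
  have key := sum_alternating_choose_mul_poch (a + b + 1) n
  rw [← mul_zero (K * (c ^ 2 - 1) ^ (n + 2) * Complex.Gamma (a + (n + 1 : ℕ)) *
    Complex.Gamma (b + 1) / Complex.Gamma (a + b + (2 * n + 2 : ℕ))), ← key, Finset.mul_sum]
  refine Finset.sum_congr rfl fun j hj => ?_
  obtain ⟨k, hk⟩ := Nat.exists_eq_add_of_le (Nat.lt_succ_iff.1 (Finset.mem_range.1 hj))
  have hk' : n + 1 - j = k := by omega
  have g1 : Complex.Gamma (a + (n + 1 : ℕ)) = poch (a + j) k * Complex.Gamma (a + j) := by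
    rw [hk, Nat.cast_add, ← add_assoc]
    exact Gamma_add_nat fun i _ hi => ha (j + i) (by push_cast; linear_combination hi)
  have hs1 : ∀ i : ℕ, a + b + 1 + j ≠ -i := fun i hi =>
    hs (1 + j + i) (by push_cast; linear_combination hi)
  have hs2 : ∀ i : ℕ, a + b + (n + 1 : ℕ) + j ≠ -i := fun i hi =>
    hs (n + 1 + j + i) (by push_cast at hi ⊢; linear_combination hi)
  have g2 : Complex.Gamma (a + b + (2 * n + 2 : ℕ)) = poch (a + b + (n + 1 : ℕ) + j) k *
      (poch (a + b + 1 + j) n * Complex.Gamma (a + b + 1 + j)) := by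
    rw [← Gamma_add_nat fun i _ => hs1 i]
    have e : a + b + 1 + j + n = a + b + (n + 1 : ℕ) + j := by push_cast; ring
    rw [e, ← Gamma_add_nat fun i _ => hs2 i]
    congr 1
    have hk2 : ((n + 1 : ℕ) : ℂ) = j + k := by exact_mod_cast hk
    push_cast at hk2 ⊢
    linear_combination hk2
  have n1 := Complex.Gamma_ne_zero hs1
  have n2 : poch (a + b + 1 + j) n ≠ 0 := poch_ne_zero fun i _ h =>
    hs1 i (eq_neg_of_add_eq_zero_left h)
  have n3 : poch (a + b + (n + 1 : ℕ) + j) k ≠ 0 := poch_ne_zero fun i _ h =>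
    hs2 i (eq_neg_of_add_eq_zero_left h)
  have e3 : (-(c ^ 2 - 1)) ^ k = (-1) ^ k * (c ^ 2 - 1) ^ k := by rw [← mul_pow]; ring
  have e4 : (c ^ 2 - 1) ^ (n + 2) = (c ^ 2 - 1) ^ k * (c ^ 2 - 1) ^ (j + 1) := by
    rw [← pow_add]; congr 1; omega
  rw [jacobiCoeff, hk', g1, g2, e3, e4, smul_eq_mul]
  field_simp

omit hα hβ hS in
theorem betaFun_one (c : ℂ) : betaFun α β c 1 = (c ^ 2 - 1) ^ ((α + β) / 2) *
    (Complex.Gamma ((α + 1) / 2) * Complex.Gamma ((β + 1) / 2) /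
        Complex.Gamma ((α + 1) / 2 + (β + 1) / 2)) := by
  simpa using betaFun_X_sub_one_pow α β c 0

/-- The weight functional annihilates every `Q_n` with `n ≥ 1`. Testing `Q_n` against `x + c` gives
`0` for `n ≥ 2` by the quadratic decomposition, and the three-term recurrence then propagates the
two explicit values at `Q_1` and `Q_2`. -/
theorem uFun_Q (c : ℂ) (n : ℕ) : uFun α β c (Q α β c (n + 1)) = 0 := by
  have e2 : 2 * ((α + 1) / 2) - 1 = α := by ring
  have e3 : 2 * ((β + 1) / 2) - 1 = β := by ring
  have hdec := Q_quadratic_decomposition c ((α + 1) / 2) ((β + 1) / 2) (halfSum_add_ne_zero hS)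
  have hF := uFun_X_add_C_mul_shiftedJacobi hα hβ hS c
  have hG : ∀ a σ : ℂ, ∀ n, uFun α β c ((X + C c) * ((X - C 1) *
      shiftedJacobi 1 (c ^ 2 - 1 ^ 2) a σ n)) = 0 := fun a σ n => by
    have hcomp : shiftedJacobi 1 (c ^ 2 - 1 ^ 2) a σ n =
      (∑ j ∈ Finset.range (n + 1), jacobiCoeff a σ (c ^ 2 - 1) n j • (X - 1 : ℂ[X]) ^ j).comp
        (X ^ 2) := by
      simp [shiftedJacobi, smul_eq_C_mul, mul_comp]
    rw [hcomp, uFun_X_add_C_mul_X_sub_one_mul]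
  rw [e2, e3] at hdec
  -- testing against `x + c`
  have htest : ∀ n, uFun α β c ((X + C c) * Q α β c (n + 2)) = 0 := by
    intro n
    obtain ⟨m, rfl | rfl⟩ := Nat.even_or_odd' n
    · rw [(hdec m).2, mul_add, map_add, hF, mul_left_comm, ← smul_eq_C_mul, map_smul, hG,
        smul_zero, add_zero]
    · have : 2 * m + 1 + 2 = 2 * (m + 1) + 1 := by ring
      rw [this, (hdec (m + 1)).1, mul_add, map_add, hG, mul_left_comm, ← smul_eq_C_mul, map_smul,
        hF, smul_zero, add_zero]
  have hb0 : bCoeff α β c 0 = -c + (c + 1) * ((β + 1) / 2) / ((α + 1) / 2 + (β + 1) / 2) := by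
    rw [← bCoeff_zero c ((α + 1) / 2) ((β + 1) / 2), e2, e3]
  have hu1 : uCoeff α β c 1 = (c + 1) ^ 2 * ((α + 1) / 2) * ((β + 1) / 2) /
      ((α + 1) / 2 + (β + 1) / 2) ^ 2 := by
    have := uCoeff_odd c ((α + 1) / 2) ((β + 1) / 2) 0
    rw [e2, e3] at this
    simpa using this
  have hσ : (α + 1) / 2 + (β + 1) / 2 ≠ 0 := by simpa using halfSum_add_ne_zero hS 0
  have hX : betaFun α β c (C (c ^ 2) - X) = betaFun α β c 1 *
      ((c ^ 2 - 1) * ((β + 1) / 2) / ((α + 1) / 2 + (β + 1) / 2)) := by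
    have h := betaFun_C_sub_X_mul hα hβ hS c 0
    have hb' : (β + 1) / 2 ≠ 0 := by simpa using half_ne_neg_nat hβ 0
    rw [pow_zero, mul_one, Nat.cast_zero, add_zero, add_zero, Complex.Gamma_add_one _ hσ,
      Complex.Gamma_add_one _ hb'] at h
    have hg := Complex.Gamma_ne_zero (halfSum_ne_neg_nat hS)
    rw [h, betaFun_one]
    field_simp
    ring
  have h1 : uFun α β c 1 = (c - 1) * betaFun α β c 1 := by
    simpa using uFun_even α β c 1
  have hXc : uFun α β c (X + C c) = betaFun α β c (C (c ^ 2) - X) := by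
    simpa using uFun_X_add_C_mul α β c 1
  have hQ1 : uFun α β c (Q α β c 1) = 0 := by
    have : Q α β c 1 = (X + C c) - (c + bCoeff α β c 0) • (1 : ℂ[X]) := by
      rw [Q, smul_eq_C_mul, C_add]; ring
    rw [this, map_sub, map_smul, hXc, hX, h1, hb0, smul_eq_mul]
    field_simp
    ring
  have hQ2 : uFun α β c (Q α β c 2) = 0 := by
    -- `Q_2` is split so that the functional is known to kill the term with `(x + c)(x - 1)`
    have hrec : Q α β c 2 = (X + C c) * ((X - C 1) * (1 : ℂ[X]).comp (X ^ 2)) +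
        (1 - bCoeff α β c 0) • (X + C c) - (c + bCoeff α β c 1) • Q α β c 1 -
        uCoeff α β c 1 • (1 : ℂ[X]) := by
      simp only [Q, zero_add, smul_eq_C_mul, C_add, C_sub, C_1, one_comp]
      ring
    rw [hrec, map_sub, map_sub, map_add, map_smul, map_smul, map_smul, hXc, hX,
      uFun_X_add_C_mul_X_sub_one_mul, hQ1, h1, hb0, hu1]
    simp only [smul_eq_mul]
    revert hσ
    generalize (α + 1) / 2 = a
    generalize (β + 1) / 2 = b
    intro hσ
    field_simp
    ring
  have hstep : ∀ n, uFun α β c (Q α β c (n + 1)) = 0 ∧ uFun α β c (Q α β c (n + 2)) = 0 := by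
    intro n
    induction n with
    | zero => exact ⟨hQ1, hQ2⟩
    | succ n ih =>
      refine ⟨ih.2, ?_⟩
      have hrec : Q α β c (n + 1 + 2) = (X + C c) * Q α β c (n + 2) -
          (c + bCoeff α β c (n + 2)) • Q α β c (n + 2) -
          uCoeff α β c (n + 2) • Q α β c (n + 1) := by
        rw [Q]
        simp only [smul_eq_C_mul, C_add]
        ring
      rw [hrec, map_sub, map_sub, map_smul, map_smul, htest, ih.1, ih.2]
      simp
  exact (hstep n).1

end

/-! ### Orthogonality and norms -/

theorem X_mul_Q (α β c : ℂ) (n : ℕ) : X * Q α β c (n + 1) = Q α β c (n + 2) +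
    bCoeff α β c (n + 1) • Q α β c (n + 1) + uCoeff α β c (n + 1) • Q α β c n := by
  rw [Q, smul_eq_C_mul, smul_eq_C_mul]; ring

/-- A functional that annihilates all `Q_n` with `n ≥ 1` makes the `Q_n` orthogonal, whether or not
some `u_n` vanishes. -/
theorem favard_orthogonal {α β c : ℂ} {L : ℂ[X] →ₗ[ℂ] ℂ}
    (hL : ∀ n, L (Q α β c (n + 1)) = 0) {n m : ℕ} (hnm : n ≠ m) :
    L (Q α β c n * Q α β c m) = 0 := by
  have hX : ∀ k m, k ≤ m → L (X ^ k * Q α β c (m + 1)) = 0 := by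
    intro k
    induction k with
    | zero => intro m _; simpa using hL m
    | succ k ih =>
      intro m hm
      obtain ⟨m, rfl⟩ : ∃ m', m = m' + 1 := ⟨m - 1, by omega⟩
      rw [pow_succ, mul_assoc, X_mul_Q, mul_add, mul_add, mul_smul_comm, mul_smul_comm, map_add,
        map_add, map_smul, map_smul, ih _ (by omega), ih _ (by omega), ih _ (by omega)]
      simp
  have hlt : ∀ n m, n < m → L (Q α β c n * Q α β c m) = 0 := by
    intro n m h
    obtain ⟨m, rfl⟩ : ∃ m', m = m' + 1 := ⟨m - 1, by omega⟩
    rw [(Q α β c n).as_sum_range_C_mul_X_pow, Finset.sum_mul, map_sum]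
    refine Finset.sum_eq_zero fun k hk => ?_
    have hd : (Q α β c n).natDegree = n :=
      natDegree_eq_of_degree_eq_some (Q_monic_degree α β c n).1.2
    rw [hd, Finset.mem_range] at hk
    rw [mul_assoc, ← smul_eq_C_mul, map_smul, hX k m (by omega), smul_zero]
  rcases lt_or_gt_of_ne hnm with h | h
  · exact hlt n m h
  · rw [mul_comm]; exact hlt m n h

theorem favard_norm_succ {α β c : ℂ} {L : ℂ[X] →ₗ[ℂ] ℂ}
    (hL : ∀ n, L (Q α β c (n + 1)) = 0) (n : ℕ) :
    L (Q α β c (n + 1) * Q α β c (n + 1)) =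
      uCoeff α β c (n + 1) * L (Q α β c n * Q α β c n) := by
  have h0 : ∀ {n m}, n ≠ m → L (Q α β c n * Q α β c m) = 0 := favard_orthogonal hL
  have h1 : L (Q α β c (n + 1) * Q α β c (n + 1)) = L (Q α β c n * (X * Q α β c (n + 1))) := by
    cases n with
    | zero =>
      have : Q α β c (0 + 1) * Q α β c (0 + 1) = Q α β c 0 * (X * Q α β c (0 + 1)) -
          bCoeff α β c 0 • (Q α β c 0 * Q α β c (0 + 1)) := by
        simp only [Q, smul_eq_C_mul]; ring
      rw [this, map_sub, map_smul, h0 (by omega)]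
      simp
    | succ n =>
      have : Q α β c (n + 1 + 1) * Q α β c (n + 1 + 1) =
          Q α β c (n + 1) * (X * Q α β c (n + 1 + 1)) -
          bCoeff α β c (n + 1) • (Q α β c (n + 1) * Q α β c (n + 1 + 1)) -
          uCoeff α β c (n + 1) • (Q α β c n * Q α β c (n + 1 + 1)) := by
        have hrec := X_mul_Q α β c n
        simp only [smul_eq_C_mul] at hrec ⊢
        linear_combination (-Q α β c (n + 1 + 1)) * hrec
      rw [this, map_sub, map_sub, map_smul, map_smul, h0 (by omega), h0 (by omega)]
      simp
  rw [h1, X_mul_Q, mul_add, mul_add, mul_smul_comm, mul_smul_comm, map_add, map_add, map_smul,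
    map_smul, h0 (by omega), h0 (by omega)]
  simp

theorem normRatio_zero (α β c : ℂ) : normRatio α β c 0 = 1 := by
  simp [normRatio, poch_zero]

theorem normRatio_comm (α β c : ℂ) (n : ℕ) : normRatio α β c n = normRatio β α c n := by
  unfold normRatio
  rw [add_comm α β, mul_comm (poch ((α + 1) / 2) (n / 2)),
    mul_comm (poch ((α + 1) / 2) ((n + 1) / 2))]

theorem normRatio_even (α β c : ℂ) (m : ℕ) : normRatio α β c (2 * m) =
    (c ^ 2 - 1) ^ (2 * m) * (m.factorial : ℂ) *
      (poch ((α + 1) / 2) m * poch ((β + 1) / 2) m) /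
      (poch ((α + β) / 2 + 1) (2 * m) * poch ((α + β) / 2 + 1 + m) m) := by
  have e : (α + β + (2 * m : ℕ)) / 2 + 1 = (α + β) / 2 + 1 + m := by push_cast; ring
  rw [normRatio, if_pos (by simp), Nat.mul_div_cancel_left _ two_pos, e]

theorem normRatio_odd (α β c : ℂ) (m : ℕ) : normRatio α β c (2 * m + 1) =
    (c - 1) ^ (2 * m) * (c + 1) ^ (2 * m + 2) * (m.factorial : ℂ) *
      (poch ((α + 1) / 2) (m + 1) * poch ((β + 1) / 2) (m + 1)) /
      (poch ((α + β) / 2 + 1) (2 * m + 1) * poch ((α + β) / 2 + 1 + m) (m + 1)) := by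
  have e : (α + β + (2 * m + 1 : ℕ) + 1) / 2 = (α + β) / 2 + 1 + m := by push_cast; ring
  have e1 : (2 * m + 1 - 1) / 2 = m := by omega
  have e2 : (2 * m + 1 + 1) / 2 = m + 1 := by omega
  rw [normRatio, if_neg (by simp), e, e1, e2, Nat.add_sub_cancel]

theorem normRatio_succ_of_le {α β : ℂ} {n : ℕ}
    (hS : ∀ k : ℕ, k ≤ n → α + β + 2 * (k + 1 : ℕ) ≠ 0) (c : ℂ) :
    normRatio α β c (n + 1) = uCoeff α β c (n + 1) * normRatio α β c n := by
  have hσ : ∀ k : ℕ, k ≤ n → (α + β) / 2 + 1 + k ≠ 0 := fun k hk h =>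
    hS k hk (by push_cast; linear_combination 2 * h)
  have e2 : 2 * ((α + 1) / 2) - 1 = α := by ring
  have e3 : 2 * ((β + 1) / 2) - 1 = β := by ring
  have es : (α + 1) / 2 + (β + 1) / 2 = (α + β) / 2 + 1 := by ring
  obtain ⟨m, rfl | rfl⟩ := Nat.even_or_odd' n
  · have hu := uCoeff_odd c ((α + 1) / 2) ((β + 1) / 2) m
    rw [e2, e3, es] at hu
    rw [hu, normRatio_odd, normRatio_even]
    generalize (α + β) / 2 + 1 = σ at *
    have p1 : poch σ (2 * m) ≠ 0 := poch_ne_zero fun k hk => hσ k (by omega)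
    have p2 : poch (σ + m) m ≠ 0 := poch_ne_zero fun k hk => by
      have := hσ (m + k) (by omega); push_cast at this; rwa [add_assoc]
    have n1 := hσ (2 * m) le_rfl
    push_cast at n1
    have e : c ^ 2 - 1 = (c - 1) * (c + 1) := by ring
    rw [poch_succ, poch_succ, poch_succ, poch_succ, e, mul_pow]
    have e5 : σ + m + m = σ + 2 * m := by ring
    push_cast
    rw [e5]
    field_simp
    ring
  · have hu := uCoeff_even c ((α + 1) / 2) ((β + 1) / 2) m
    rw [e2, e3, es] at hu
    have e6 : 2 * m + 1 + 1 = 2 * (m + 1) := by ring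
    rw [hu, normRatio_odd, e6, normRatio_even]
    generalize (α + β) / 2 + 1 = σ at *
    have p1 : poch σ (2 * m + 1) ≠ 0 := poch_ne_zero fun k hk => hσ k (by omega)
    have p2 : poch (σ + m) (m + 1) ≠ 0 := poch_ne_zero fun k hk => by
      have := hσ (m + k) (by omega); push_cast at this; rwa [add_assoc]
    have n0 := hσ m (by omega)
    have n1 := hσ (2 * m + 1) le_rfl
    push_cast at n1
    have e : c ^ 2 - 1 = (c - 1) * (c + 1) := by ring
    have p3 : poch (σ + (m + 1 : ℕ)) (m + 1) =
        poch (σ + m) (m + 1) * (σ + 2 * m + 1) / (σ + m) := by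
      rw [eq_div_iff n0]
      have h1 := poch_succ_left (σ + m) (m + 1)
      rw [poch_succ _ (m + 1)] at h1
      have h2 : σ + m + 1 = σ + (m + 1 : ℕ) := by push_cast; ring
      rw [h2] at h1
      push_cast at h1 ⊢
      linear_combination -h1
    have e7 : 2 * (m + 1) = 2 * m + 1 + 1 := by ring
    rw [p3, e7, poch_succ σ (2 * m + 1), e, mul_pow, Nat.factorial_succ]
    have e8 : σ + (2 * m + 1 : ℕ) = σ + 2 * m + 1 := by push_cast; ring
    rw [e8]
    have n2 : σ + 2 * m + 1 ≠ 0 := by rwa [add_assoc]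
    push_cast
    field_simp
    ring

theorem normRatio_succ {α β : ℂ} (hS : ∀ n : ℕ, 1 ≤ n → α + β + 2 * n ≠ 0) (c : ℂ) (n : ℕ) :
    normRatio α β c (n + 1) = uCoeff α β c (n + 1) * normRatio α β c n :=
  normRatio_succ_of_le (fun k _ => hS (k + 1) (by omega)) c

theorem hNorm_succ {α β : ℂ} (hS : ∀ n : ℕ, 1 ≤ n → α + β + 2 * n ≠ 0) (c : ℂ) (n : ℕ) :
    hNorm α β c (n + 1) = uCoeff α β c (n + 1) * hNorm α β c n := by
  rw [hNorm, hNorm, normRatio_succ hS]; ring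

theorem uFun_one (α β c : ℂ) : uFun α β c 1 = (c - 1) * ((c ^ 2 - 1) ^ ((α + β) / 2) *
    (Complex.Gamma ((α + 1) / 2) * Complex.Gamma ((β + 1) / 2) /
        Complex.Gamma ((α + 1) / 2 + (β + 1) / 2))) := by
  rw [← betaFun_one]
  simpa using uFun_even α β c 1

theorem uFun_one_comm (α β c : ℂ) : uFun α β c 1 = uFun β α c 1 := by
  rw [uFun_one, uFun_one, add_comm α β, add_comm ((α + 1) / 2),
    mul_comm (Complex.Gamma ((α + 1) / 2))]

theorem hNorm_comm (α β c : ℂ) (n : ℕ) : hNorm α β c n = hNorm β α c n := by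
  rw [hNorm, hNorm, uFun_one_comm, normRatio_comm]

section Nondegenerate

variable {α β c : ℂ} (hc₁ : c ≠ 1) (hc₂ : c ≠ -1)
  (hα : ∀ k : ℕ, α ≠ -(2 * k + 1)) (hβ : ∀ k : ℕ, β ≠ -(2 * k + 1))
  (hS : ∀ n : ℕ, 1 ≤ n → α + β + 2 * n ≠ 0)

include hc₁ hc₂ in
theorem sq_sub_one_ne_zero : c ^ 2 - 1 ≠ 0 := by
  have h : c ^ 2 - 1 = (c - 1) * (c + 1) := by ring
  rw [h]
  exact mul_ne_zero (sub_ne_zero.2 hc₁) fun h => hc₂ (eq_neg_of_add_eq_zero_left h)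

include hα hβ hS

theorem uFun_orthogonal {n m : ℕ} (hnm : n ≠ m) : uFun α β c (Q α β c n * Q α β c m) = 0 :=
  favard_orthogonal (uFun_Q hα hβ hS c) hnm

theorem uFun_Q_mul_self (n : ℕ) : uFun α β c (Q α β c n * Q α β c n) = hNorm α β c n := by
  induction n with
  | zero => simp [Q, hNorm, normRatio_zero]
  | succ n ih => rw [favard_norm_succ (uFun_Q hα hβ hS c), ih, hNorm_succ hS]

include hc₁ hc₂

theorem hNorm_ne_zero (n : ℕ) : hNorm α β c n ≠ 0 := by
  induction n with
  | zero =>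
    rw [hNorm, normRatio_zero, mul_one, uFun_one]
    refine mul_ne_zero (sub_ne_zero.2 hc₁) (mul_ne_zero ?_ (div_ne_zero (mul_ne_zero
      (Complex.Gamma_ne_zero (half_ne_neg_nat hα)) (Complex.Gamma_ne_zero (half_ne_neg_nat hβ)))
      (Complex.Gamma_ne_zero (halfSum_ne_neg_nat hS))))
    exact fun h => sq_sub_one_ne_zero hc₁ hc₂ ((Complex.cpow_eq_zero_iff _ _).1 h).1
  | succ n ih =>
    rw [hNorm_succ hS]
    refine mul_ne_zero (uCoeff_ne_zero hc₁ hc₂ hS (by omega) ?_ ?_) ih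
    · rintro ⟨k, hk⟩ h
      rw [hk] at h
      exact hα k (by push_cast at h; linear_combination h)
    · rintro ⟨k, hk⟩ h
      rw [hk] at h
      exact hβ k (by push_cast at h; linear_combination h)

end Nondegenerate

/-! ### Iterated lowering operators -/

theorem reflectX_apply (p : ℂ[X]) : reflectX p = p.comp (-X) := by
  simp [reflectX, comp_eq_aeval]

theorem reflectX_mul (p q : ℂ[X]) : reflectX (p * q) = reflectX p * reflectX q := by
  simp [reflectX_apply]

theorem reflectX_involutive : Function.Involutive reflectX := fun p => by
  rw [reflectX_apply, reflectX_apply, comp_assoc]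
  simp

theorem tauAlpha_Q_zero (α β c : ℂ) : tauAlpha α β c (Q α β c 0) = 0 := by
  have h : Q α β c 0 = QBasis α β c 0 := ((QSeq α β c).basis_eq_self (QSeq_isUnit α β c) 0).symm
  rw [h, tauAlpha, Module.Basis.constr_basis]

theorem tauAlpha_Q_succ (α β c : ℂ) (n : ℕ) :
    tauAlpha α β c (Q α β c (n + 1)) = reflectX (Q (α + 2) β (-c) n) := by
  have h : Q α β c (n + 1) = QBasis α β c (n + 1) :=
    ((QSeq α β c).basis_eq_self (QSeq_isUnit α β c) (n + 1)).symm
  rw [h, tauAlpha, Module.Basis.constr_basis]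

theorem tauBeta_Q_zero (α β c : ℂ) : tauBeta α β c (Q α β c 0) = 0 := by
  have h : Q α β c 0 = QBasis α β c 0 := ((QSeq α β c).basis_eq_self (QSeq_isUnit α β c) 0).symm
  rw [h, tauBeta, Module.Basis.constr_basis]

theorem tauBeta_Q_succ (α β c : ℂ) (n : ℕ) :
    tauBeta α β c (Q α β c (n + 1)) = Q α (β + 2) (-c) n := by
  have h : Q α β c (n + 1) = QBasis α β c (n + 1) :=
    ((QSeq α β c).basis_eq_self (QSeq_isUnit α β c) (n + 1)).symm
  rw [h, tauBeta, Module.Basis.constr_basis]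

theorem tauAlphaPow_Q_of_lt (α β c : ℂ) {k n : ℕ} (h : n < k) :
    tauAlphaPow k α β c (Q α β c n) = 0 := by
  induction k generalizing α c n with
  | zero => omega
  | succ k ih =>
    simp only [tauAlphaPow, LinearMap.comp_apply]
    cases n with
    | zero => simp [tauAlpha_Q_zero]
    | succ n =>
      rw [tauAlpha_Q_succ, reflectX_involutive, ih _ _ (by omega), map_zero]

theorem tauAlphaPow_Q_add (α β c : ℂ) (k n : ℕ) : tauAlphaPow k α β c (Q α β c (k + n)) =
    reflectX^[k] (Q (α + 2 * k) β ((-1) ^ k * c) n) := by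
  induction k generalizing α c with
  | zero => simp [tauAlphaPow]
  | succ k ih =>
    have e1 : k + 1 + n = k + n + 1 := by ring
    have e2 : α + 2 + 2 * k = α + 2 * (k + 1 : ℕ) := by push_cast; ring
    have e3 : (-1) ^ k * -c = (-1) ^ (k + 1) * c := by ring
    simp only [tauAlphaPow, LinearMap.comp_apply]
    rw [e1, tauAlpha_Q_succ, reflectX_involutive, ih, e2, e3, Function.iterate_succ_apply']

theorem tauBetaPow_Q_of_lt (α β c : ℂ) {k n : ℕ} (h : n < k) :
    tauBetaPow k α β c (Q α β c n) = 0 := by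
  induction k generalizing β c n with
  | zero => omega
  | succ k ih =>
    simp only [tauBetaPow, LinearMap.comp_apply]
    cases n with
    | zero => simp [tauBeta_Q_zero]
    | succ n => rw [tauBeta_Q_succ, ih _ _ (by omega)]

theorem tauBetaPow_Q_add (α β c : ℂ) (k n : ℕ) : tauBetaPow k α β c (Q α β c (k + n)) =
    Q α (β + 2 * k) ((-1) ^ k * c) n := by
  induction k generalizing β c with
  | zero => simp [tauBetaPow]
  | succ k ih =>
    have e1 : k + 1 + n = k + n + 1 := by ring
    have e2 : β + 2 + 2 * k = β + 2 * (k + 1 : ℕ) := by push_cast; ring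
    have e3 : (-1) ^ k * -c = (-1) ^ (k + 1) * c := by ring
    simp only [tauBetaPow, LinearMap.comp_apply]
    rw [e1, tauBeta_Q_succ, ih, e2, e3]

theorem tauAlphaPow_degenerate (N : ℕ) (β c : ℂ) (n : ℕ) :
    tauAlphaPow (2 * N + 1) (-2 * N - 1) β c (Q (-2 * N - 1) β c (2 * N + 1 + n)) =
      reflectX (Q (2 * N + 1) β (-c) n) := by
  have e : (-2 * N - 1 : ℂ) + 2 * (2 * N + 1 : ℕ) = 2 * N + 1 := by push_cast; ring
  have e' : (-1 : ℂ) ^ (2 * N + 1) * c = -c := by rw [pow_succ, pow_mul]; simp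
  rw [tauAlphaPow_Q_add, reflectX_involutive.iterate_odd (by simp), e, e']

theorem tauBetaPow_degenerate (N : ℕ) (α c : ℂ) (n : ℕ) :
    tauBetaPow (2 * N + 1) α (-2 * N - 1) c (Q α (-2 * N - 1) c (2 * N + 1 + n)) =
      Q α (2 * N + 1) (-c) n := by
  have e : (-2 * N - 1 : ℂ) + 2 * (2 * N + 1 : ℕ) = 2 * N + 1 := by push_cast; ring
  have e' : (-1 : ℂ) ^ (2 * N + 1) * c = -c := by rw [pow_succ, pow_mul]; simp
  rw [tauBetaPow_Q_add, e, e']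

/-! ### Discrete functionals and Sobolev orthogonality -/

/-- A functional that vanishes on the multiples of `P` is a combination of the Hermite evaluations
at the zeros of `P`: over `ℂ` their common kernel consists of the multiples of `P`. -/
theorem isDiscreteAtZeros_of_dvd {P : ℂ[X]} (hP : P ≠ 0) {ℓ : ℂ[X] →ₗ[ℂ] ℂ}
    (h : ∀ f, P ∣ f → ℓ f = 0) : IsDiscreteAtZeros P ℓ := by
  let L : (Σ z : {z // z ∈ P.roots.toFinset}, Fin (P.rootMultiplicity z.1)) → ℂ[X] →ₗ[ℂ] ℂ :=
    fun i => Polynomial.leval (i.1 : ℂ) ∘ₗ (Polynomial.derivative ^ (i.2 : ℕ))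
  have hL : ∀ i f, L i f = (Polynomial.derivative^[i.2] f).eval (i.1 : ℂ) := fun i f => by
    simp [L, Module.End.pow_apply, Polynomial.leval]
  have hker : ⨅ i, LinearMap.ker (L i) ≤ LinearMap.ker ℓ := by
    intro f hf
    simp only [Submodule.mem_iInf, LinearMap.mem_ker, hL] at hf ⊢
    apply h
    by_cases hf0 : f = 0
    · simp [hf0]
    rw [IsAlgClosed.dvd_iff_roots_le_roots hP hf0, Multiset.le_iff_count]
    intro z
    rw [count_roots, count_roots]
    rcases Nat.eq_zero_or_pos (P.rootMultiplicity z) with hz | hz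
    · omega
    have hzr : z ∈ P.roots.toFinset := by
      rw [Multiset.mem_toFinset, mem_roots hP]
      exact (rootMultiplicity_pos hP).1 hz
    have := (lt_rootMultiplicity_iff_isRoot_iterate_derivative (p := f) (t := z)
      (n := P.rootMultiplicity z - 1) hf0).2 fun m hm =>
        hf ⟨⟨z, hzr⟩, ⟨m, by dsimp only; omega⟩⟩
    omega
  obtain ⟨a, ha⟩ := (Submodule.mem_span_range_iff_exists_fun ℂ).1 (mem_span_of_iInf_ker_le_ker hker)
  refine ⟨fun z j => if hz : z ∈ P.roots.toFinset then
    if hj : j < P.rootMultiplicity z then a ⟨⟨z, hz⟩, ⟨j, hj⟩⟩ else 0 else 0, fun f => ?_⟩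
  rw [← ha, LinearMap.sum_apply, Fintype.sum_sigma, ← Finset.sum_coe_sort P.roots.toFinset]
  refine Finset.sum_congr rfl fun z _ => ?_
  rw [Finset.sum_range]
  refine Finset.sum_congr rfl fun j _ => ?_
  rw [LinearMap.smul_apply, hL, smul_eq_mul]
  beta_reduce
  rw [dif_pos z.2, dif_pos j.2]

/-- The functional dual to `Q_0` in the basis `(Q_n)`, that is `Q_n ↦ δ_{n0}`. -/
noncomputable def favardFun (α β c : ℂ) : ℂ[X] →ₗ[ℂ] ℂ :=
  (QBasis α β c).constr ℂ fun n => if n = 0 then 1 else 0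

theorem favardFun_one (α β c : ℂ) : favardFun α β c 1 = 1 := by
  have h : (1 : ℂ[X]) = QBasis α β c 0 := ((QSeq α β c).basis_eq_self (QSeq_isUnit α β c) 0).symm
  rw [h, favardFun, Module.Basis.constr_basis, if_pos rfl]

theorem favardFun_Q_succ (α β c : ℂ) (n : ℕ) : favardFun α β c (Q α β c (n + 1)) = 0 := by
  have h : Q α β c (n + 1) = QBasis α β c (n + 1) :=
    ((QSeq α β c).basis_eq_self (QSeq_isUnit α β c) (n + 1)).symm
  rw [h, favardFun, Module.Basis.constr_basis, if_neg (by omega)]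

/-- If `u_{M+1} = 0`, the recurrence never leads from indices `≥ M + 1` to smaller ones, so
`favardFun` vanishes on all multiples of `Q_n` for `n ≥ M + 1`. -/
theorem favardFun_mul_Q_of_uCoeff_eq_zero {α β c : ℂ} {M : ℕ} (hu : uCoeff α β c (M + 1) = 0)
    (f : ℂ[X]) (n : ℕ) : favardFun α β c (f * Q α β c (M + 1 + n)) = 0 := by
  have hX : ∀ k n, favardFun α β c (X ^ k * Q α β c (M + 1 + n)) = 0 := by
    intro k
    induction k with
    | zero =>
      intro n
      have e : M + 1 + n = M + n + 1 := by ring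
      rw [pow_zero, one_mul, e, favardFun_Q_succ]
    | succ k ih =>
      intro n
      have h0 : uCoeff α β c (M + n + 1) • favardFun α β c (X ^ k * Q α β c (M + n)) = 0 := by
        cases n with
        | zero => rw [add_zero, hu, zero_smul]
        | succ n => rw [← add_assoc, add_right_comm M n 1, ih n, smul_zero]
      have h1 := ih n
      have h2 := ih (n + 1)
      rw [← add_assoc, add_right_comm M 1 n] at h2
      rw [add_right_comm M 1 n] at h1 ⊢
      rw [pow_succ, mul_assoc, X_mul_Q, mul_add, mul_add, mul_smul_comm, mul_smul_comm, map_add,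
        map_add, map_smul, map_smul, h0, h1, h2]
      simp
  rw [f.as_sum_range_C_mul_X_pow, Finset.sum_mul, map_sum]
  refine Finset.sum_eq_zero fun k _ => ?_
  rw [mul_assoc, ← smul_eq_C_mul, map_smul, hX, smul_zero]

theorem favardFun_Q_mul_self {α β : ℂ} (hS : ∀ n : ℕ, 1 ≤ n → α + β + 2 * n ≠ 0) (c : ℂ) (n : ℕ) :
    favardFun α β c (Q α β c n * Q α β c n) = normRatio α β c n := by
  induction n with
  | zero => simp [Q, favardFun_one, normRatio_zero]
  | succ n ih => rw [favard_norm_succ (favardFun_Q_succ α β c), ih, normRatio_succ hS]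

/-- Orthogonality and norms for a Sobolev form when `u` vanishes exactly at `M + 1`: the discrete
part only sees the indices `≤ M`, and the part through `T` only those `≥ M + 1`. -/
theorem sobolevForm_favard {α β c : ℂ} {M : ℕ} (hS : ∀ n : ℕ, 1 ≤ n → α + β + 2 * n ≠ 0)
    (hu : ∀ n, 1 ≤ n → (uCoeff α β c n = 0 ↔ n = M + 1))
    {T : ℂ[X] →ₗ[ℂ] ℂ[X]} {v : ℂ[X] →ₗ[ℂ] ℂ} {h : ℕ → ℂ} {lam : ℂ} (hlam : lam ≠ 0)
    (hT : ∀ n, n < M + 1 → T (Q α β c n) = 0)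
    (hv : ∀ n m, n ≠ m → v (T (Q α β c (M + 1 + n)) * T (Q α β c (M + 1 + m))) = 0)
    (hv' : ∀ n, v (T (Q α β c (M + 1 + n)) * T (Q α β c (M + 1 + n))) = h n)
    (hh : ∀ n, h n ≠ 0) (hsucc : ∀ n, h (n + 1) = uCoeff α β c (M + 1 + (n + 1)) * h n)
    {B : ℂ[X] → ℂ[X] → ℂ} (hB : B = sobolevForm (favardFun α β c) lam v T) :
    (∀ n m : ℕ, n ≠ m → B (Q α β c n) (Q α β c m) = 0) ∧
    (∀ n : ℕ, B (Q α β c n) (Q α β c n) ≠ 0) ∧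
    (∀ n : ℕ, n < M + 1 → B (Q α β c n) (Q α β c n) = normRatio α β c n) ∧
    (∀ n : ℕ, B (Q α β c (M + 1 + n)) (Q α β c (M + 1 + n)) = lam * h n) ∧
    (∀ n : ℕ, 1 ≤ n → n ≠ M + 1 → B (Q α β c n) (Q α β c n) =
      uCoeff α β c n * B (Q α β c (n - 1)) (Q α β c (n - 1))) := by
  have hu0 : uCoeff α β c (M + 1) = 0 := (hu _ (by omega)).2 rfl
  have hlow : ∀ n, n < M + 1 → B (Q α β c n) (Q α β c n) = normRatio α β c n := by
    intro n hn
    rw [hB, sobolevForm, hT n hn, zero_mul, map_zero, mul_zero, add_zero, favardFun_Q_mul_self hS]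
  have hhigh : ∀ n, B (Q α β c (M + 1 + n)) (Q α β c (M + 1 + n)) = lam * h n := by
    intro n
    rw [hB, sobolevForm, favardFun_mul_Q_of_uCoeff_eq_zero hu0, hv', zero_add]
  have hr : ∀ n, n < M + 1 → normRatio α β c n ≠ 0 := by
    intro n
    induction n with
    | zero => intro _; simp [normRatio_zero]
    | succ n ih =>
      intro hn
      rw [normRatio_succ hS]
      exact mul_ne_zero (fun h0 => absurd ((hu _ (by omega)).1 h0) (by omega)) (ih (by omega))
  refine ⟨fun n m hnm => ?_, fun n => ?_, hlow, hhigh, fun n hn hne => ?_⟩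
  · rw [hB, sobolevForm, favard_orthogonal (favardFun_Q_succ α β c) hnm, zero_add]
    rcases lt_or_ge n (M + 1) with h1 | h1
    · rw [hT n h1, zero_mul, map_zero, mul_zero]
    rcases lt_or_ge m (M + 1) with h2 | h2
    · rw [hT m h2, mul_zero, map_zero, mul_zero]
    obtain ⟨n, rfl⟩ := Nat.exists_eq_add_of_le h1
    obtain ⟨m, rfl⟩ := Nat.exists_eq_add_of_le h2
    rw [hv n m (by omega), mul_zero]
  · rcases lt_or_ge n (M + 1) with h1 | h1
    · rw [hlow n h1]; exact hr n h1
    · obtain ⟨n, rfl⟩ := Nat.exists_eq_add_of_le h1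
      rw [hhigh]; exact mul_ne_zero hlam (hh n)
  · obtain ⟨n, rfl⟩ : ∃ k, n = k + 1 := ⟨n - 1, by omega⟩
    rw [Nat.add_sub_cancel]
    rcases lt_or_ge (n + 1) (M + 1) with h1 | h1
    · rw [hlow _ h1, hlow _ (by omega), normRatio_succ hS]
    · obtain ⟨k, rfl⟩ : ∃ k, n = M + 1 + k := ⟨n - (M + 1), by omega⟩
      rw [add_assoc (M + 1), hhigh, hhigh, hsucc]
      ring

/-! ### Limits of the norms at a degenerate parameter -/

theorem continuous_poch (n : ℕ) : Continuous fun a : ℂ => poch a n :=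
  (ascPochhammer ℂ n).continuous

theorem continuousAt_uCoeff {α β : ℂ} (c : ℂ) {n : ℕ} (h : α + β + 2 * n ≠ 0) :
    ContinuousAt (fun t => uCoeff t β c n) α := by
  unfold uCoeff
  have hd : (α + β + 2 * n) ^ 2 ≠ 0 := pow_ne_zero _ h
  split_ifs
  · exact ContinuousAt.div (by fun_prop) (by fun_prop) hd
  · exact ContinuousAt.div (by fun_prop) (by fun_prop) hd

section

variable {N : ℕ} {β c : ℂ} (hc₁ : c ≠ 1) (hc₂ : c ≠ -1)
  (hS : ∀ n : ℕ, 1 ≤ n → (-2 * N - 1 : ℂ) + β + 2 * n ≠ 0)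

include hS in
theorem ne_neg_odd_of_degenerate (k : ℕ) : β ≠ -(2 * k + 1) := fun h =>
  hS (N + k + 1) (by omega) (by rw [h]; push_cast; ring)

include hS in
theorem shifted_sum_ne_zero (n : ℕ) (_ : 1 ≤ n) : (2 * N + 1 : ℂ) + β + 2 * n ≠ 0 := by
  have := hS (2 * N + 1 + n) (by omega)
  push_cast at this
  intro h
  apply this
  linear_combination h

theorem two_mul_add_one_ne_neg_odd (N k : ℕ) : (2 * N + 1 : ℂ) ≠ -(2 * k + 1) := by
  intro h
  have h' : ((2 * N + 1 + (2 * k + 1) : ℕ) : ℂ) = 0 := by push_cast; linear_combination h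
  exact absurd (Nat.cast_eq_zero.1 h') (by omega)

/-- `h_{2N+1}(t, β, c)` with the pole of `Γ((t + 1) / 2)` at `t = -2N-1` cancelled against
the zero of the Pochhammer symbol `((t + 1) / 2)_{N+1}`. -/
noncomputable def degenerateNorm (N : ℕ) (β c : ℂ) (t : ℂ) : ℂ :=
  (c - 1) * ((c ^ 2 - 1) ^ ((t + β) / 2) *
    (Complex.Gamma ((t + 1) / 2 + (N + 1 : ℕ)) * Complex.Gamma ((β + 1) / 2) /
        Complex.Gamma ((t + 1) / 2 + (β + 1) / 2))) *
  ((c - 1) ^ (2 * N) * (c + 1) ^ (2 * N + 2) * (N.factorial : ℂ) * poch ((β + 1) / 2) (N + 1) /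
      (poch ((t + β) / 2 + 1) (2 * N + 1) * poch ((t + β) / 2 + 1 + N) (N + 1)))

theorem hNorm_eq_degenerateNorm (β c : ℂ) {t : ℂ} (ht : ∀ k, k < N + 1 → (t + 1) / 2 ≠ -(k : ℂ)) :
    hNorm t β c (2 * N + 1) = degenerateNorm N β c t := by
  rw [hNorm, uFun_one, normRatio_odd, degenerateNorm, Gamma_add_nat ht]
  ring

theorem eventually_half_ne (N : ℕ) :
    ∀ᶠ t : ℂ in 𝓝[≠] (-2 * N - 1 : ℂ), ∀ k, k < N + 1 → (t + 1) / 2 ≠ -(k : ℂ) := by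
  have : ∀ k ∈ Finset.range (N + 1), ∀ᶠ t : ℂ in 𝓝[≠] (-2 * N - 1 : ℂ), (t + 1) / 2 ≠ -(k : ℂ) := by
    intro k hk
    rcases Nat.lt_succ_iff_lt_or_eq.1 (Finset.mem_range.1 hk) with h | rfl
    · have hne : (-2 * N - 1 : ℂ) ≠ -2 * k - 1 := fun h0 => by
        have : (N : ℂ) = k := by linear_combination (-1 / 2) * h0
        exact h.ne' (by exact_mod_cast this)
      filter_upwards [nhdsWithin_le_nhds (isOpen_ne.mem_nhds hne)] with t ht h0
      exact ht (by linear_combination 2 * h0)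
    · filter_upwards [self_mem_nhdsWithin] with t ht h0
      exact ht (by rw [Set.mem_singleton_iff]; linear_combination 2 * h0)
  filter_upwards [(Filter.eventually_all_finset _).2 this] with t ht k hk
  exact ht k (Finset.mem_range.2 hk)

include hS in
theorem continuousAt_degenerateNorm (hc : c ^ 2 - 1 ≠ 0) :
    ContinuousAt (degenerateNorm N β c) (-2 * N - 1) := by
  have hσ := halfSum_ne_neg_nat hS
  have es : ((-2 * N - 1 : ℂ) + 1) / 2 + (β + 1) / 2 = ((-2 * N - 1 : ℂ) + β) / 2 + 1 := by ring
  have hp1 : poch (((-2 * N - 1 : ℂ) + β) / 2 + 1) (2 * N + 1) ≠ 0 := poch_ne_zero fun k _ h =>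
    hσ k (by linear_combination h)
  have hp2 : poch (((-2 * N - 1 : ℂ) + β) / 2 + 1 + N) (N + 1) ≠ 0 := poch_ne_zero fun k _ h =>
    hσ (N + k) (by push_cast; linear_combination h)
  have hg1 : ContinuousAt Complex.Gamma (((-2 * N - 1 : ℂ) + 1) / 2 + (N + 1 : ℕ)) := by
    have e : ((-2 * N - 1 : ℂ) + 1) / 2 + (N + 1 : ℕ) = 1 := by push_cast; ring
    rw [e]
    refine (Complex.differentiableAt_Gamma 1 fun m h => ?_).continuousAt
    have h' : ((1 + m : ℕ) : ℂ) = 0 := by push_cast; linear_combination h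
    exact absurd (Nat.cast_eq_zero.1 h') (by omega)
  have hg2 : ContinuousAt Complex.Gamma (((-2 * N - 1 : ℂ) + 1) / 2 + (β + 1) / 2) :=
    (Complex.differentiableAt_Gamma _ hσ).continuousAt
  have hg1' : ContinuousAt (fun t : ℂ => Complex.Gamma ((t + 1) / 2 + (N + 1 : ℕ)))
      (-2 * N - 1) :=
    ContinuousAt.comp (f := fun t : ℂ => (t + 1) / 2 + (N + 1 : ℕ)) hg1 (by fun_prop)
  have hg2' : ContinuousAt (fun t : ℂ => Complex.Gamma ((t + 1) / 2 + (β + 1) / 2))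
      (-2 * N - 1) :=
    ContinuousAt.comp (f := fun t : ℂ => (t + 1) / 2 + (β + 1) / 2) hg2 (by fun_prop)
  have hq1 : ContinuousAt (fun t : ℂ => poch ((t + β) / 2 + 1) (2 * N + 1)) (-2 * N - 1) :=
    ((continuous_poch _).comp (by fun_prop)).continuousAt
  have hq2 : ContinuousAt (fun t : ℂ => poch ((t + β) / 2 + 1 + N) (N + 1)) (-2 * N - 1) :=
    ((continuous_poch _).comp (by fun_prop)).continuousAt
  have hpow : ContinuousAt (fun t : ℂ => (c ^ 2 - 1) ^ ((t + β) / 2)) (-2 * N - 1) :=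
    ContinuousAt.const_cpow (by fun_prop) (Or.inl hc)
  exact (continuousAt_const.mul (hpow.mul ((hg1'.mul continuousAt_const).div hg2'
    (Complex.Gamma_ne_zero hσ)))).mul (continuousAt_const.div (hq1.mul hq2)
      (mul_ne_zero hp1 hp2))

include hc₁ hc₂ hS in
theorem degenerateNorm_ne_zero : degenerateNorm N β c (-2 * N - 1) ≠ 0 := by
  have hσ := halfSum_ne_neg_nat hS
  have hβ := half_ne_neg_nat (ne_neg_odd_of_degenerate hS)
  have hp0 : poch ((β + 1) / 2) (N + 1) ≠ 0 := poch_ne_zero fun k _ h =>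
    hβ k (by linear_combination h)
  have hp1 : poch (((-2 * N - 1 : ℂ) + β) / 2 + 1) (2 * N + 1) ≠ 0 := poch_ne_zero fun k _ h =>
    hσ k (by linear_combination h)
  have hp2 : poch (((-2 * N - 1 : ℂ) + β) / 2 + 1 + N) (N + 1) ≠ 0 := poch_ne_zero fun k _ h =>
    hσ (N + k) (by push_cast; linear_combination h)
  have e : ((-2 * N - 1 : ℂ) + 1) / 2 + (N + 1 : ℕ) = 1 := by push_cast; ring
  have h1 : c - 1 ≠ 0 := sub_ne_zero.2 hc₁
  have h2 : c + 1 ≠ 0 := fun h => hc₂ (eq_neg_of_add_eq_zero_left h)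
  have hpow : (c ^ 2 - 1) ^ (((-2 * N - 1 : ℂ) + β) / 2) ≠ 0 := fun h =>
    sq_sub_one_ne_zero hc₁ hc₂ ((Complex.cpow_eq_zero_iff _ _).1 h).1
  have hf : (N.factorial : ℂ) ≠ 0 := by exact_mod_cast N.factorial_ne_zero
  rw [degenerateNorm, e, Complex.Gamma_one, one_mul]
  exact mul_ne_zero (mul_ne_zero h1 (mul_ne_zero hpow (div_ne_zero (Complex.Gamma_ne_zero hβ)
    (Complex.Gamma_ne_zero hσ)))) (div_ne_zero (mul_ne_zero (mul_ne_zero (mul_ne_zero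
      (pow_ne_zero _ h1) (pow_ne_zero _ h2)) hf) hp0) (mul_ne_zero hp1 hp2))

include hc₁ hc₂ hS in
theorem tendsto_hNorm_degenerate (n : ℕ) :
    Tendsto (fun t : ℂ => hNorm t β c (2 * N + 1 + n)) (𝓝[≠] (-2 * N - 1))
      (𝓝 (degenerateNorm N β c (-2 * N - 1) * normRatio (2 * N + 1) β (-c) n)) := by
  induction n with
  | zero =>
    rw [normRatio_zero, mul_one, add_zero]
    refine ((continuousAt_degenerateNorm hS (sq_sub_one_ne_zero hc₁ hc₂)).tendsto.mono_left
      nhdsWithin_le_nhds).congr' ?_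
    filter_upwards [eventually_half_ne N] with t ht
    rw [hNorm_eq_degenerateNorm β c ht]
  | succ n ih =>
    have hev : ∀ᶠ t : ℂ in 𝓝[≠] (-2 * N - 1 : ℂ), ∀ k ∈ Finset.range (2 * N + 1 + n + 1),
        t + β + 2 * (k + 1 : ℕ) ≠ 0 := by
      refine (Filter.eventually_all_finset _).2 fun k _ => nhdsWithin_le_nhds ?_
      have hcont : Continuous fun t : ℂ => t + β + 2 * (k + 1 : ℕ) := by fun_prop
      exact hcont.continuousAt.eventually_ne (hS (k + 1) (by omega))
    have hu : Tendsto (fun t => uCoeff t β c (2 * N + 1 + (n + 1))) (𝓝[≠] (-2 * N - 1))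
        (𝓝 (uCoeff (-2 * N - 1) β c (2 * N + 1 + (n + 1)))) :=
      (continuousAt_uCoeff c (hS _ (by omega))).tendsto.mono_left nhdsWithin_le_nhds
    have hlim := hu.mul ih
    rw [uCoeff_shift, mul_left_comm, ← normRatio_succ (shifted_sum_ne_zero hS)] at hlim
    refine hlim.congr' ?_
    filter_upwards [hev] with t ht
    rw [hNorm, hNorm, ← add_assoc,
      normRatio_succ_of_le fun k hk => ht k (Finset.mem_range.2 (Nat.lt_succ_of_le hk))]
    ring

end

/-! ### Integral representation of the weight functional -/

theorem sq_sqrt_one_add {r s : ℝ} (hs : s ∈ Set.Icc (0 : ℝ) 1) :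
    √(1 + (r ^ 2 - 1) * s) ^ 2 = 1 + (r ^ 2 - 1) * s :=
  Real.sq_sqrt (by nlinarith [sq_nonneg r, hs.1, hs.2, mul_nonneg (sq_nonneg r) hs.1])

theorem one_add_mul_pos {r s : ℝ} (hs : s ∈ Set.Ioo (0 : ℝ) 1) : 0 < 1 + (r ^ 2 - 1) * s := by
  nlinarith [sq_nonneg r, hs.1, hs.2, mul_nonneg (sq_nonneg r) hs.1.le]

theorem hasDerivAt_sqrt_one_add {r s : ℝ} (hs : s ∈ Set.Ioo (0 : ℝ) 1) :
    HasDerivAt (fun s => √(1 + (r ^ 2 - 1) * s))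
      ((r ^ 2 - 1) / (2 * √(1 + (r ^ 2 - 1) * s))) s := by
  have h : HasDerivAt (fun s : ℝ => 1 + (r ^ 2 - 1) * s) (r ^ 2 - 1) s := by
    simpa using ((hasDerivAt_id s).const_mul (r ^ 2 - 1)).const_add 1
  exact h.sqrt (one_add_mul_pos hs).ne'

theorem image_sqrt_one_add {r : ℝ} (hr : r ^ 2 ≠ 1) :
    (fun s => √(1 + (r ^ 2 - 1) * s)) '' Set.Ioo (0 : ℝ) 1 = Set.uIoo 1 |r| := by
  have he : r ^ 2 - 1 ≠ 0 := sub_ne_zero.2 hr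
  have habs : |r| ^ 2 = r ^ 2 := sq_abs r
  have h0 := abs_nonneg r
  ext x
  constructor
  · rintro ⟨s, hs, rfl⟩
    have h1 := sq_sqrt_one_add (r := r) (Set.Ioo_subset_Icc_self hs)
    have h2 : 0 < √(1 + (r ^ 2 - 1) * s) := Real.sqrt_pos.2 (one_add_mul_pos hs)
    dsimp only
    generalize √(1 + (r ^ 2 - 1) * s) = y at *
    obtain ⟨hs0, hs1⟩ := hs
    rcases lt_or_gt_of_ne he with h | h
    · have : |r| < 1 := by nlinarith
      rw [Set.uIoo_of_ge this.le]
      constructor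
      · exact lt_of_pow_lt_pow_left₀ 2 h2.le (by nlinarith)
      · exact lt_of_pow_lt_pow_left₀ 2 zero_le_one (by nlinarith)
    · have : 1 < |r| := by nlinarith
      rw [Set.uIoo_of_le this.le]
      constructor
      · exact lt_of_pow_lt_pow_left₀ 2 h2.le (by nlinarith)
      · exact lt_of_pow_lt_pow_left₀ 2 h0 (by nlinarith)
  · intro hx
    have key : ∀ s, s = (x ^ 2 - 1) / (r ^ 2 - 1) → 0 < x → √(1 + (r ^ 2 - 1) * s) = x := by
      rintro s rfl hx0
      rw [mul_div_cancel₀ _ he, add_sub_cancel, Real.sqrt_sq hx0.le]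
    rcases lt_or_gt_of_ne he with h | h
    · have : |r| < 1 := by nlinarith
      rw [Set.uIoo_of_ge this.le] at hx
      obtain ⟨hx1, hx2⟩ := hx
      refine ⟨_, ⟨?_, ?_⟩, key _ rfl (by linarith)⟩
      · exact div_pos_of_neg_of_neg (by nlinarith) h
      · rw [div_lt_one_of_neg h]; nlinarith
    · have : 1 < |r| := by nlinarith
      rw [Set.uIoo_of_le this.le] at hx
      obtain ⟨hx1, hx2⟩ := hx
      refine ⟨_, ⟨?_, ?_⟩, key _ rfl (by linarith)⟩
      · exact div_pos (by nlinarith) h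
      · rw [div_lt_one h]; nlinarith

/-- The substitution `x = √(1 + (r² - 1) s)`, with integrability transferred from the `s`-side. The
integral from `1` to `|r|` is oriented, so both signs of `r² - 1` are covered. -/
theorem intervalIntegral_sqrt_substitution {r : ℝ} (hr : r ^ 2 ≠ 1) {g : ℝ → ℂ}
    (h : IntervalIntegrable (fun s => ((r ^ 2 - 1) / (2 * √(1 + (r ^ 2 - 1) * s))) •
      g √(1 + (r ^ 2 - 1) * s)) volume 0 1) :
    IntervalIntegrable g volume 1 |r| ∧
      ∫ x in (1 : ℝ)..|r|, g x = ∫ s in (0 : ℝ)..1,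
        ((r ^ 2 - 1) / (2 * √(1 + (r ^ 2 - 1) * s))) • g √(1 + (r ^ 2 - 1) * s) := by
  have he : r ^ 2 - 1 ≠ 0 := sub_ne_zero.2 hr
  have habs : |r| ^ 2 = r ^ 2 := sq_abs r
  have h0 := abs_nonneg r
  have hderiv : ∀ s ∈ Set.Ioo (0 : ℝ) 1, HasDerivWithinAt (fun s => √(1 + (r ^ 2 - 1) * s))
      ((r ^ 2 - 1) / (2 * √(1 + (r ^ 2 - 1) * s))) (Set.Ioo 0 1) s := fun s hs =>
    (hasDerivAt_sqrt_one_add hs).hasDerivWithinAt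
  have hinj : Set.InjOn (fun s => √(1 + (r ^ 2 - 1) * s)) (Set.Ioo 0 1) := by
    intro s hs t ht hst
    have h1 := sq_sqrt_one_add (r := r) (Set.Ioo_subset_Icc_self hs)
    have h2 := sq_sqrt_one_add (r := r) (Set.Ioo_subset_Icc_self ht)
    dsimp only at hst
    rw [hst, h2] at h1
    exact mul_left_cancel₀ he (by linarith)
  have hpos : ∀ s ∈ Set.Ioo (0 : ℝ) 1, 0 < √(1 + (r ^ 2 - 1) * s) := fun s hs =>
    Real.sqrt_pos.2 (one_add_mul_pos hs)
  have hI := integrableOn_image_iff_integrableOn_abs_deriv_smul measurableSet_Ioo hderiv hinj g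
  have hJ := integral_image_eq_integral_abs_deriv_smul measurableSet_Ioo hderiv hinj g
  rw [image_sqrt_one_add hr] at hI hJ
  rw [intervalIntegrable_iff_integrableOn_Ioo_of_le zero_le_one] at h
  rw [intervalIntegral.integral_of_le zero_le_one, integral_Ioc_eq_integral_Ioo]
  rcases lt_or_gt_of_ne he with hlt | hgt
  · have hr1 : |r| < 1 := by nlinarith
    have hcongr : Set.EqOn (fun s => |(r ^ 2 - 1) / (2 * √(1 + (r ^ 2 - 1) * s))| •
        g √(1 + (r ^ 2 - 1) * s)) (fun s => -(((r ^ 2 - 1) / (2 * √(1 + (r ^ 2 - 1) * s))) •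
        g √(1 + (r ^ 2 - 1) * s))) (Set.Ioo 0 1) := fun s hs => by
      dsimp only
      rw [abs_of_neg (div_neg_of_neg_of_pos hlt (mul_pos two_pos (hpos s hs))), neg_smul]
    rw [Set.uIoo_of_ge hr1.le] at hI hJ
    rw [integrableOn_congr_fun hcongr measurableSet_Ioo] at hI
    rw [setIntegral_congr_fun measurableSet_Ioo hcongr, integral_neg] at hJ
    refine ⟨IntervalIntegrable.symm ?_, ?_⟩
    · rw [intervalIntegrable_iff_integrableOn_Ioo_of_le hr1.le]
      exact hI.2 h.neg
    · rw [intervalIntegral.integral_of_ge hr1.le, integral_Ioc_eq_integral_Ioo, hJ, neg_neg]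
  · have hr1 : 1 < |r| := by nlinarith
    have hcongr : Set.EqOn (fun s => |(r ^ 2 - 1) / (2 * √(1 + (r ^ 2 - 1) * s))| •
        g √(1 + (r ^ 2 - 1) * s)) (fun s => ((r ^ 2 - 1) / (2 * √(1 + (r ^ 2 - 1) * s))) •
        g √(1 + (r ^ 2 - 1) * s)) (Set.Ioo 0 1) := fun s hs => by
      dsimp only
      rw [abs_of_pos (div_pos hgt (mul_pos two_pos (hpos s hs)))]
    rw [Set.uIoo_of_le hr1.le] at hI hJ
    rw [integrableOn_congr_fun hcongr measurableSet_Ioo] at hI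
    rw [setIntegral_congr_fun measurableSet_Ioo hcongr] at hJ
    refine ⟨?_, ?_⟩
    · rw [intervalIntegrable_iff_integrableOn_Ioo_of_le hr1.le]
      exact hI.2 h
    · rw [intervalIntegral.integral_of_le hr1.le, integral_Ioc_eq_integral_Ioo, hJ]

/-- The Jacobi weight on the segment from `1` to `c²` in the parameter `s` of `t = 1 + (c² - 1) s`,
including the factor `dt / ds`. -/
noncomputable def betaDensity (α β c : ℂ) (s : ℝ) : ℂ :=
  (c ^ 2 - 1) ^ ((α + β) / 2) * ((s : ℂ) ^ ((α + 1) / 2 - 1) * (1 - s : ℂ) ^ ((β + 1) / 2 - 1))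

section

variable {α β c : ℂ} (hα : -1 < α.re) (hβ : -1 < β.re)

include hα in
theorem half_re_pos : 0 < ((α + 1) / 2).re := by
  have : ((α + 1) / 2).re = (α.re + 1) / 2 := by simp
  rw [this]; linarith

include hα hβ

theorem intervalIntegrable_betaDensity (c : ℂ) :
    IntervalIntegrable (betaDensity α β c) volume 0 1 :=
  (Complex.betaIntegral_convergent (half_re_pos hα) (half_re_pos hβ)).const_mul _

theorem intervalIntegrable_eval_mul_betaDensity (c : ℂ) (q : ℂ[X]) :
    IntervalIntegrable (fun s : ℝ => q.eval (1 + (c ^ 2 - 1) * (s : ℂ)) * betaDensity α β c s)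
      volume 0 1 := by
  refine (intervalIntegrable_betaDensity hα hβ c).continuousOn_mul (Continuous.continuousOn ?_)
  exact q.continuous.comp (by fun_prop)

theorem betaFun_eq_integral (c : ℂ) (q : ℂ[X]) : betaFun α β c q =
    ∫ s in (0 : ℝ)..1, q.eval (1 + (c ^ 2 - 1) * (s : ℂ)) * betaDensity α β c s := by
  have key : ∀ p : ℂ[X], ((Polynomial.basisMonomials ℂ).constr ℂ fun j =>
      (c ^ 2 - 1) ^ ((α + β) / 2) * ((c ^ 2 - 1) ^ j *
        (Complex.Gamma ((α + 1) / 2 + j) * Complex.Gamma ((β + 1) / 2) /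
        Complex.Gamma ((α + 1) / 2 + (β + 1) / 2 + j)))) p =
      ∫ s in (0 : ℝ)..1, p.eval ((c ^ 2 - 1) * (s : ℂ)) * betaDensity α β c s := by
    intro p
    induction p using Polynomial.induction_on' with
    | add p q hp hq =>
      have hint : ∀ p : ℂ[X], IntervalIntegrable
          (fun s : ℝ => p.eval ((c ^ 2 - 1) * (s : ℂ)) * betaDensity α β c s) volume 0 1 := fun p =>
        (intervalIntegrable_betaDensity hα hβ c).continuousOn_mul
          (Continuous.continuousOn (p.continuous.comp (by fun_prop)))
      rw [map_add, hp, hq, ← intervalIntegral.integral_add (hint p) (hint q)]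
      simp only [eval_add, add_mul]
    | monomial n w =>
      have hre : 0 < ((α + 1) / 2 + n).re := by
        have := half_re_pos hα
        rw [Complex.add_re, Complex.natCast_re]
        positivity
      have hb := Complex.betaIntegral_eq_Gamma_mul_div _ _ hre (half_re_pos hβ)
      have e : (α + 1) / 2 + (β + 1) / 2 + n = (α + 1) / 2 + n + (β + 1) / 2 := by ring
      rw [basisMonomials_constr_monomial, e, ← hb, Complex.betaIntegral,
        ← intervalIntegral.integral_const_mul, ← intervalIntegral.integral_const_mul,
        ← intervalIntegral.integral_const_mul]
      refine intervalIntegral.integral_congr_uIoo fun s hs => ?_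
      rw [Set.uIoo_of_le zero_le_one] at hs
      have hs0 : (s : ℂ) ≠ 0 := by exact_mod_cast hs.1.ne'
      have e2 : (α + 1) / 2 + n - 1 = (α + 1) / 2 - 1 + n := by ring
      rw [eval_monomial, betaDensity, e2, Complex.cpow_add _ _ hs0, Complex.cpow_natCast, mul_pow]
      ring
  rw [betaFun, LinearMap.comp_apply, key]
  simp only [taylor_eval, add_comm (1 : ℂ)]

omit hα hβ in
theorem weight_mul_eq (hc : c ^ 2 - 1 ≠ 0) {s : ℝ} (hs : s ∈ Set.Ioo (0 : ℝ) 1) {x : ℂ}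
    (hx : x ^ 2 = 1 + (c ^ 2 - 1) * s) :
    weight α β c x * (c ^ 2 - 1) = (x + 1) * (c - x) * betaDensity α β c s := by
  have mul_cpow : ∀ {u : ℝ}, 0 < u → ∀ z : ℂ,
      ((u : ℂ) * (c ^ 2 - 1)) ^ z = (u : ℂ) ^ z * (c ^ 2 - 1) ^ z := fun {u} hu z => by
    have hu' : (u : ℂ) ≠ 0 := by exact_mod_cast hu.ne'
    rw [Complex.cpow_def_of_ne_zero (mul_ne_zero hu' hc), Complex.cpow_def_of_ne_zero hu',
      Complex.cpow_def_of_ne_zero hc, Complex.log_ofReal_mul hu hc, Complex.ofReal_log hu.le,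
      add_mul, Complex.exp_add]
  have h1 : x ^ 2 - 1 = (s : ℂ) * (c ^ 2 - 1) := by rw [hx]; ring
  have h2 : c ^ 2 - x ^ 2 = ((1 - s : ℝ) : ℂ) * (c ^ 2 - 1) := by rw [hx]; push_cast; ring
  have e1 : (α + 1) / 2 - 1 = (α - 1) / 2 := by ring
  have e2 : (β + 1) / 2 - 1 = (β - 1) / 2 := by ring
  have e3 : (α + β) / 2 = (α - 1) / 2 + (β - 1) / 2 + 1 := by ring
  rw [weight, betaDensity, h1, h2, mul_cpow hs.1, mul_cpow (sub_pos.2 hs.2), e1, e2, e3,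
    Complex.cpow_add _ _ hc, Complex.cpow_add _ _ hc, Complex.cpow_one]
  push_cast
  ring

theorem uFun_eq_curve_integral (hc : c ^ 2 - 1 ≠ 0) (p : ℂ[X]) {γ : ℝ → ℂ}
    (hγ : ∀ s, γ s ^ 2 = 1 + (c ^ 2 - 1) * (s : ℂ)) :
    IntervalIntegrable (fun s : ℝ =>
        p.eval (γ s) * weight α β c (γ s) * ((c ^ 2 - 1) / (2 * γ s)) +
        p.eval (-γ s) * weight α β c (-γ s) * ((c ^ 2 - 1) / (2 * (-γ s)))) volume 0 1 ∧
      uFun α β c p = ∫ s in (0 : ℝ)..1,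
        (p.eval (γ s) * weight α β c (γ s) * ((c ^ 2 - 1) / (2 * γ s)) +
        p.eval (-γ s) * weight α β c (-γ s) * ((c ^ 2 - 1) / (2 * (-γ s)))) := by
  -- the curve meets the branch point `0` for at most one value of `s`
  have hae : ∀ᵐ s : ℝ ∂(volume.restrict (Set.uIoc 0 1)), s ∈ Set.Ioo (0 : ℝ) 1 ∧ γ s ≠ 0 := by
    rw [ae_restrict_iff' measurableSet_uIoc]
    filter_upwards [Measure.ae_ne volume (1 : ℝ),
      Measure.ae_ne volume (-1 / (c ^ 2 - 1)).re] with s h1 h2 hs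
    rw [Set.uIoc_of_le zero_le_one] at hs
    refine ⟨⟨hs.1, lt_of_le_of_ne hs.2 h1⟩, fun h0 => h2 ?_⟩
    have h := hγ s
    rw [h0] at h
    have : (s : ℂ) = -1 / (c ^ 2 - 1) := by
      rw [eq_div_iff hc]; linear_combination -h
    rw [← this, Complex.ofReal_re]
  have hpt : ∀ s : ℝ, s ∈ Set.Ioo (0 : ℝ) 1 → γ s ≠ 0 → ∀ p : ℂ[X],
      p.eval (γ s) * weight α β c (γ s) * ((c ^ 2 - 1) / (2 * γ s)) +
        p.eval (-γ s) * weight α β c (-γ s) * ((c ^ 2 - 1) / (2 * (-γ s))) =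
      (p.eval (γ s) * ((γ s + 1) * (c - γ s)) - p.eval (-γ s) * ((-γ s + 1) * (c + γ s))) /
        (2 * γ s) * betaDensity α β c s := by
    intro s hs h0 p
    have w1 := weight_mul_eq (α := α) (β := β) hc hs (hγ s)
    have w2 := weight_mul_eq (α := α) (β := β) hc hs (x := -γ s) (by rw [neg_sq, hγ s])
    field_simp
    linear_combination p.eval (γ s) * w1 - p.eval (-γ s) * w2
  have mono : ∀ (p q : ℂ[X]), uFun α β c p = betaFun α β c q →
      (∀ x : ℂ, x ≠ 0 → (p.eval x * ((x + 1) * (c - x)) - p.eval (-x) * ((-x + 1) * (c + x))) /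
        (2 * x) = q.eval (x ^ 2)) →
      IntervalIntegrable (fun s : ℝ =>
        p.eval (γ s) * weight α β c (γ s) * ((c ^ 2 - 1) / (2 * γ s)) +
        p.eval (-γ s) * weight α β c (-γ s) * ((c ^ 2 - 1) / (2 * (-γ s)))) volume 0 1 ∧
      uFun α β c p = ∫ s in (0 : ℝ)..1,
        (p.eval (γ s) * weight α β c (γ s) * ((c ^ 2 - 1) / (2 * γ s)) +
        p.eval (-γ s) * weight α β c (-γ s) * ((c ^ 2 - 1) / (2 * (-γ s)))) := by
    intro p q hu hpq
    have hEq : (fun s : ℝ => q.eval (1 + (c ^ 2 - 1) * (s : ℂ)) * betaDensity α β c s)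
        =ᵐ[volume.restrict (Set.uIoc 0 1)] (fun s : ℝ =>
        p.eval (γ s) * weight α β c (γ s) * ((c ^ 2 - 1) / (2 * γ s)) +
        p.eval (-γ s) * weight α β c (-γ s) * ((c ^ 2 - 1) / (2 * (-γ s)))) := by
      filter_upwards [hae] with s hs
      rw [hpt s hs.1 hs.2, hpq _ hs.2, hγ s]
    exact ⟨(intervalIntegrable_eval_mul_betaDensity hα hβ c q).congr_ae hEq, by
      rw [hu, betaFun_eq_integral hα hβ, intervalIntegral.integral_congr_ae_restrict hEq]⟩
  induction p using Polynomial.induction_on' with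
  | add p q hp hq =>
    have hsum : (fun s : ℝ =>
        (p + q).eval (γ s) * weight α β c (γ s) * ((c ^ 2 - 1) / (2 * γ s)) +
        (p + q).eval (-γ s) * weight α β c (-γ s) * ((c ^ 2 - 1) / (2 * (-γ s)))) =
        fun s => (p.eval (γ s) * weight α β c (γ s) * ((c ^ 2 - 1) / (2 * γ s)) +
        p.eval (-γ s) * weight α β c (-γ s) * ((c ^ 2 - 1) / (2 * (-γ s)))) +
        (q.eval (γ s) * weight α β c (γ s) * ((c ^ 2 - 1) / (2 * γ s)) +
        q.eval (-γ s) * weight α β c (-γ s) * ((c ^ 2 - 1) / (2 * (-γ s)))) := by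
      funext s
      rw [eval_add, eval_add]
      ring
    rw [hsum]
    exact ⟨hp.1.add hq.1, by rw [map_add, hp.2, hq.2, ← intervalIntegral.integral_add hp.1 hq.1]⟩
  | monomial n w =>
    rw [← C_mul_X_pow_eq_monomial]
    obtain ⟨k, rfl | rfl⟩ := Nat.even_or_odd' n
    · refine mono _ (C (c - 1) * (C w * X ^ k)) ?_ fun x hx => ?_
      · have h := uFun_even α β c (C w * X ^ k)
        simp only [mul_comp, C_comp, X_pow_comp, ← pow_mul] at h
        rw [h, ← smul_eq_mul, ← map_smul, smul_eq_C_mul]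
      · simp only [eval_mul, eval_C, eval_pow, eval_X, pow_mul, neg_sq]
        field_simp
        ring
    · refine mono _ ((C c - X) * (C w * X ^ k)) ?_ fun x hx => ?_
      · rw [← uFun_odd]
        congr 1
        simp only [mul_comp, C_comp, X_pow_comp]
        ring
      · simp only [eval_mul, eval_C, eval_pow, eval_X, eval_sub, pow_succ _ (2 * k), pow_mul,
          neg_sq]
        field_simp
        ring

/-- For real `c` each of the two branches `ε = ±1` is integrable on its own, also for `c = 0`, where
the branches meet at `x = 0` and `1 / (2 x)` is unbounded. -/
theorem intervalIntegrable_real_branch {r : ℝ} (hr : (r : ℂ) ^ 2 - 1 ≠ 0) {p : ℂ[X]} {ε : ℝ}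
    (hε : ε ^ 2 = 1) :
    IntervalIntegrable (fun s : ℝ =>
      p.eval ((ε * √(1 + (r ^ 2 - 1) * s) : ℝ) : ℂ) *
        weight α β r ((ε * √(1 + (r ^ 2 - 1) * s) : ℝ) : ℂ) *
        (((r : ℂ) ^ 2 - 1) / (2 * ((ε * √(1 + (r ^ 2 - 1) * s) : ℝ) : ℂ)))) volume 0 1 := by
  have hx : ∀ s ∈ Set.Ioo (0 : ℝ) 1, ((ε * √(1 + (r ^ 2 - 1) * s) : ℝ) : ℂ) ^ 2 =
      1 + ((r : ℂ) ^ 2 - 1) * s := fun s hs => by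
    rw [← Complex.ofReal_pow, mul_pow, hε, one_mul, sq_sqrt_one_add (Set.Ioo_subset_Icc_self hs)]
    push_cast
    ring
  have hε0 : ε ≠ 0 := by rintro rfl; norm_num at hε
  have hx0 : ∀ s ∈ Set.Ioo (0 : ℝ) 1, ((ε * √(1 + (r ^ 2 - 1) * s) : ℝ) : ℂ) ≠ 0 := fun s hs => by
    exact_mod_cast mul_ne_zero hε0 (Real.sqrt_pos.2 (one_add_mul_pos hs)).ne'
  have hform : ∀ s ∈ Set.Ioo (0 : ℝ) 1, ∀ x : ℂ, x = ((ε * √(1 + (r ^ 2 - 1) * s) : ℝ) : ℂ) →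
      p.eval x * weight α β r x * (((r : ℂ) ^ 2 - 1) / (2 * x)) =
      p.eval x * (x + 1) * ((r - x) / (2 * x)) * betaDensity α β r s := by
    rintro s hs x rfl
    have w := weight_mul_eq (α := α) (β := β) hr hs (hx s hs)
    have := hx0 s hs
    field_simp
    linear_combination (p.eval ((ε * √(1 + (r ^ 2 - 1) * s) : ℝ) : ℂ)) * w
  have hcont : Continuous fun s : ℝ => ((ε * √(1 + (r ^ 2 - 1) * s) : ℝ) : ℂ) := by fun_prop
  have hd := intervalIntegrable_betaDensity hα hβ (r : ℂ)
  by_cases hr0 : r = 0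
  · -- for `c = 0` the factor `c - x` of the weight cancels the singularity at `x = 0`
    refine (hd.continuousOn_mul (g := fun s : ℝ =>
      p.eval ((ε * √(1 + (r ^ 2 - 1) * s) : ℝ) : ℂ) *
        (((ε * √(1 + (r ^ 2 - 1) * s) : ℝ) : ℂ) + 1) * (-1 / 2)) ?_).congr_uIoo ?_
    · exact Continuous.continuousOn
        (((p.continuous.comp hcont).mul (hcont.add continuous_const)).mul continuous_const)
    · intro s hs
      rw [Set.uIoo_of_le zero_le_one] at hs
      dsimp only
      rw [hform s hs _ rfl]
      have h0 := hx0 s hs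
      generalize ((ε * √(1 + (r ^ 2 - 1) * s) : ℝ) : ℂ) = x at *
      have : ((r : ℂ) - x) / (2 * x) = -1 / 2 := by
        rw [hr0, Complex.ofReal_zero]; field_simp; ring
      rw [this]
  · refine (hd.continuousOn_mul (g := fun s : ℝ =>
      p.eval ((ε * √(1 + (r ^ 2 - 1) * s) : ℝ) : ℂ) *
        (((ε * √(1 + (r ^ 2 - 1) * s) : ℝ) : ℂ) + 1) *
        ((r - ((ε * √(1 + (r ^ 2 - 1) * s) : ℝ) : ℂ)) /
          (2 * ((ε * √(1 + (r ^ 2 - 1) * s) : ℝ) : ℂ)))) ?_).congr_uIoo ?_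
    · refine ((p.continuous.comp hcont).mul (hcont.add continuous_const)).continuousOn.mul
        ((continuous_const.sub hcont).continuousOn.div (continuous_const.mul hcont).continuousOn ?_)
      intro s hs
      rw [Set.uIcc_of_le zero_le_one] at hs
      have hpos : 0 < 1 + (r ^ 2 - 1) * s := by
        have := sq_pos_of_ne_zero hr0
        rcases hs.1.eq_or_lt with h | h
        · rw [← h]; norm_num
        · nlinarith [mul_pos this h, hs.2]
      refine mul_ne_zero two_ne_zero ?_
      exact_mod_cast mul_ne_zero hε0 (Real.sqrt_pos.2 hpos).ne'
    · intro s hs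
      rw [Set.uIoo_of_le zero_le_one] at hs
      dsimp only
      rw [hform s hs _ rfl]

theorem uFun_eq_real_integral {r : ℝ} (hr : (r : ℂ) ^ 2 - 1 ≠ 0) (p : ℂ[X]) :
    IntervalIntegrable (fun x : ℝ => p.eval (x : ℂ) * (((x / |x| : ℝ) : ℂ) * weight α β r x))
        volume (-|r|) (-1) ∧
      IntervalIntegrable (fun x : ℝ => p.eval (x : ℂ) * (((x / |x| : ℝ) : ℂ) * weight α β r x))
        volume 1 |r| ∧
      uFun α β r p =
        (∫ x in (-|r|)..(-1), p.eval (x : ℂ) * (((x / |x| : ℝ) : ℂ) * weight α β r x)) +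
        (∫ x in (1 : ℝ)..|r|, p.eval (x : ℂ) * (((x / |x| : ℝ) : ℂ) * weight α β r x)) := by
  have hr2 : r ^ 2 ≠ 1 := fun h => hr (by rw [← Complex.ofReal_pow, h]; simp)
  set g : ℝ → ℂ := fun x => p.eval (x : ℂ) * (((x / |x| : ℝ) : ℂ) * weight α β r x) with hg
  set H : ℝ → ℝ → ℂ := fun ε s =>
    p.eval ((ε * √(1 + (r ^ 2 - 1) * s) : ℝ) : ℂ) *
      weight α β r ((ε * √(1 + (r ^ 2 - 1) * s) : ℝ) : ℂ) *
      (((r : ℂ) ^ 2 - 1) / (2 * ((ε * √(1 + (r ^ 2 - 1) * s) : ℝ) : ℂ))) with hH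
  have hI : ∀ ε : ℝ, ε ^ 2 = 1 → IntervalIntegrable (H ε) volume 0 1 := fun ε hε =>
    intervalIntegrable_real_branch hα hβ hr hε
  have hEq : ∀ ε : ℝ, ε = 1 ∨ ε = -1 → Set.EqOn (H ε) (fun s =>
      ((r ^ 2 - 1) / (2 * √(1 + (r ^ 2 - 1) * s))) • g (ε * √(1 + (r ^ 2 - 1) * s)))
      (Set.uIoo 0 1) := by
    intro ε hε s hs
    rw [Set.uIoo_of_le zero_le_one] at hs
    have hpos := Real.sqrt_pos.2 (one_add_mul_pos (r := r) hs)
    simp only [hH, hg, Complex.real_smul]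
    generalize √(1 + (r ^ 2 - 1) * s) = y at *
    have hy : (y : ℂ) ≠ 0 := by exact_mod_cast hpos.ne'
    rcases hε with rfl | rfl
    · rw [one_mul, abs_of_pos hpos, div_self hpos.ne']
      push_cast
      ring
    · rw [neg_one_mul, abs_neg, abs_of_pos hpos, neg_div, div_self hpos.ne']
      push_cast
      field_simp
  have hsub : ∀ ε : ℝ, ε = 1 ∨ ε = -1 → IntervalIntegrable (fun x => g (ε * x)) volume 1 |r| ∧
      ∫ x in (1 : ℝ)..|r|, g (ε * x) = ∫ s in (0 : ℝ)..1, H ε s := by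
    intro ε hε
    have hε2 : ε ^ 2 = 1 := by rcases hε with rfl | rfl <;> norm_num
    have h := intervalIntegral_sqrt_substitution hr2 (g := fun x => g (ε * x))
      ((hI ε hε2).congr_uIoo (hEq ε hε))
    exact ⟨h.1, h.2.trans (intervalIntegral.integral_congr_uIoo (hEq ε hε)).symm⟩
  have h1 := hsub 1 (Or.inl rfl)
  have h2 := hsub (-1) (Or.inr rfl)
  simp only [one_mul] at h1
  simp only [neg_one_mul] at h2
  have hneg : IntervalIntegrable g volume (-|r|) (-1) := by
    have := (IntervalIntegrable.iff_comp_neg (f := g) (a := -1) (b := -|r|) (by finiteness)).2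
      (by simpa using h2.1)
    exact this.symm
  refine ⟨hneg, h1.1, ?_⟩
  rw [← intervalIntegral.integral_comp_neg, h1.2, h2.2, add_comm,
    ← intervalIntegral.integral_add (hI 1 (by norm_num)) (hI (-1) (by norm_num))]
  have hγ : ∀ s : ℝ, ((1 + ((r : ℂ) ^ 2 - 1) * (s : ℂ)) ^ (1 / 2 : ℂ)) ^ 2 =
      1 + ((r : ℂ) ^ 2 - 1) * (s : ℂ) := fun s => by
    rw [one_div]; exact Complex.cpow_nat_inv_pow _ two_ne_zero
  rw [(uFun_eq_curve_integral hα hβ hr p hγ).2]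
  refine intervalIntegral.integral_congr_uIoo fun s hs => ?_
  rw [Set.uIoo_of_le zero_le_one] at hs
  have hroot : (1 + ((r : ℂ) ^ 2 - 1) * (s : ℂ)) ^ (1 / 2 : ℂ) =
      ((√(1 + (r ^ 2 - 1) * s) : ℝ) : ℂ) := by
    rw [Real.sqrt_eq_rpow, Complex.ofReal_cpow (one_add_mul_pos hs).le]
    push_cast
    ring_nf
  simp only [hH, hroot]
  push_cast
  ring_nf

end

/-! ### The degenerate cases -/

/-- Sobolev orthogonality for `α = -2N-1`. The discrete functional is `favardFun`, and the second
term of the form pulls back the nondegenerate orthogonality for the parameters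
`(2N + 1, β, -c)`. -/
theorem exists_sobolev_orthogonal_alpha {N : ℕ} {β c : ℂ} (hc₁ : c ≠ 1) (hc₂ : c ≠ -1)
    (hS : ∀ n : ℕ, 1 ≤ n → (-2 * N - 1 : ℂ) + β + 2 * n ≠ 0) :
    ∃ lam : ℂ, lam ≠ 0 ∧
      Tendsto (fun t : ℂ => hNorm t β c (2 * N + 1)) (𝓝[≠] (-2 * N - 1)) (𝓝 lam) ∧
      ∃ ℓ₀ : ℂ[X] →ₗ[ℂ] ℂ, ℓ₀ 1 = 1 ∧
        IsDiscreteAtZeros (Q (-2 * N - 1) β c (2 * N + 1)) ℓ₀ ∧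
        ∀ B : ℂ[X] → ℂ[X] → ℂ,
          B = sobolevForm ℓ₀ lam (uFun₁ (-2 * N - 1) β c)
            (tauAlphaPow (2 * N + 1) (-2 * N - 1) β c) →
          (∀ n m : ℕ, n ≠ m → B (Q (-2 * N - 1) β c n) (Q (-2 * N - 1) β c m) = 0) ∧
          (∀ n : ℕ, B (Q (-2 * N - 1) β c n) (Q (-2 * N - 1) β c n) ≠ 0) ∧
          (∀ n : ℕ, n < 2 * N + 1 → B (Q (-2 * N - 1) β c n) (Q (-2 * N - 1) β c n) =
            normRatio (-2 * N - 1) β c n) ∧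
          (∀ n : ℕ, B (Q (-2 * N - 1) β c (2 * N + 1 + n)) (Q (-2 * N - 1) β c (2 * N + 1 + n)) =
            lam * hNorm (2 * N + 1) β (-c) n) ∧
          (∀ n : ℕ, Tendsto (fun t : ℂ => hNorm t β c (2 * N + 1 + n)) (𝓝[≠] (-2 * N - 1))
            (𝓝 (lam * normRatio (2 * N + 1) β (-c) n))) ∧
          (∀ n : ℕ, 1 ≤ n → n ≠ 2 * N + 1 → B (Q (-2 * N - 1) β c n) (Q (-2 * N - 1) β c n) =
            uCoeff (-2 * N - 1) β c n *
              B (Q (-2 * N - 1) β c (n - 1)) (Q (-2 * N - 1) β c (n - 1))) := by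
  have hc₁' : -c ≠ 1 := fun h => hc₂ (by rw [← h, neg_neg])
  have hc₂' : -c ≠ -1 := fun h => hc₁ (neg_injective h)
  have hu : ∀ n, 1 ≤ n → (uCoeff (-2 * N - 1) β c n = 0 ↔ n = 2 * N + 1) := fun n hn =>
    uCoeff_eq_zero_iff_of_alpha hc₁ hc₂ hS hn
  have hβ := ne_neg_odd_of_degenerate hS
  have hS' := shifted_sum_ne_zero hS
  have hN := two_mul_add_one_ne_neg_odd N
  have hT : ∀ n, n < 2 * N + 1 →
      tauAlphaPow (2 * N + 1) (-2 * N - 1) β c (Q (-2 * N - 1) β c n) = 0 := fun n hn =>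
    tauAlphaPow_Q_of_lt _ _ _ hn
  have hT' := tauAlphaPow_degenerate N β c
  have hlim := tendsto_hNorm_degenerate hc₁ hc₂ hS
  have hlam := degenerateNorm_ne_zero hc₁ hc₂ hS
  have hv : ∀ n m, uFun₁ (-2 * N - 1) β c
      (tauAlphaPow (2 * N + 1) (-2 * N - 1) β c (Q (-2 * N - 1) β c (2 * N + 1 + n)) *
        tauAlphaPow (2 * N + 1) (-2 * N - 1) β c (Q (-2 * N - 1) β c (2 * N + 1 + m))) =
      uFun (2 * N + 1) β (-c) (Q (2 * N + 1) β (-c) n * Q (2 * N + 1) β (-c) m) := by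
    intro n m
    have e : -(-2 * N - 1 : ℂ) = 2 * N + 1 := by ring
    rw [hT', hT', uFun₁, LinearMap.comp_apply, reflectX_mul, reflectX_involutive,
      reflectX_involutive, e]
  refine ⟨_, hlam, ?_, favardFun (-2 * N - 1) β c, favardFun_one _ _ _, ?_, ?_⟩
  · simpa [normRatio_zero] using hlim 0
  · refine isDiscreteAtZeros_of_dvd (Q_monic_degree _ _ _ _).1.1.ne_zero ?_
    rintro _ ⟨f, rfl⟩
    rw [mul_comm (Q (-2 * N - 1) β c (2 * N + 1)) f]
    exact favardFun_mul_Q_of_uCoeff_eq_zero ((hu _ (by omega)).2 rfl) f 0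
  · intro B hB
    have h := sobolevForm_favard (M := 2 * N) (h := hNorm (2 * N + 1) β (-c)) hS hu hlam hT
      (fun n m hnm => by rw [hv, uFun_orthogonal hN hβ hS' hnm])
      (fun n => by rw [hv, uFun_Q_mul_self hN hβ hS'])
      (fun n => hNorm_ne_zero hc₁' hc₂' hN hβ hS' n)
      (fun n => by rw [uCoeff_shift, hNorm_succ hS']) hB
    exact ⟨h.1, h.2.1, h.2.2.1, h.2.2.2.1, hlim, h.2.2.2.2⟩

/-- Sobolev orthogonality for `β = -2N-1`. The limits are those of the first degenerate case, because
`h_n` is symmetric in `α` and `β`. -/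
theorem exists_sobolev_orthogonal_beta {N : ℕ} {α c : ℂ} (hc₁ : c ≠ 1) (hc₂ : c ≠ -1)
    (hS : ∀ n : ℕ, 1 ≤ n → α + (-2 * N - 1 : ℂ) + 2 * n ≠ 0) :
    ∃ lam : ℂ, lam ≠ 0 ∧
      Tendsto (fun t : ℂ => hNorm t α c (2 * N + 1)) (𝓝[≠] (-2 * N - 1)) (𝓝 lam) ∧
      ∃ ℓ₁ : ℂ[X] →ₗ[ℂ] ℂ, ℓ₁ 1 = 1 ∧
        IsDiscreteAtZeros (Q α (-2 * N - 1) c (2 * N + 1)) ℓ₁ ∧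
        ∀ B : ℂ[X] → ℂ[X] → ℂ,
          B = sobolevForm ℓ₁ lam (uFun₂ α (-2 * N - 1) c)
            (tauBetaPow (2 * N + 1) α (-2 * N - 1) c) →
          (∀ n m : ℕ, n ≠ m → B (Q α (-2 * N - 1) c n) (Q α (-2 * N - 1) c m) = 0) ∧
          (∀ n : ℕ, B (Q α (-2 * N - 1) c n) (Q α (-2 * N - 1) c n) ≠ 0) ∧
          (∀ n : ℕ, n < 2 * N + 1 → B (Q α (-2 * N - 1) c n) (Q α (-2 * N - 1) c n) =
            normRatio α (-2 * N - 1) c n) ∧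
          (∀ n : ℕ, B (Q α (-2 * N - 1) c (2 * N + 1 + n)) (Q α (-2 * N - 1) c (2 * N + 1 + n)) =
            lam * hNorm α (2 * N + 1) (-c) n) ∧
          (∀ n : ℕ, Tendsto (fun t : ℂ => hNorm α t c (2 * N + 1 + n)) (𝓝[≠] (-2 * N - 1))
            (𝓝 (lam * normRatio α (2 * N + 1) (-c) n))) ∧
          (∀ n : ℕ, 1 ≤ n → n ≠ 2 * N + 1 → B (Q α (-2 * N - 1) c n) (Q α (-2 * N - 1) c n) =
            uCoeff α (-2 * N - 1) c n *
              B (Q α (-2 * N - 1) c (n - 1)) (Q α (-2 * N - 1) c (n - 1))) := by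
  have hc₁' : -c ≠ 1 := fun h => hc₂ (by rw [← h, neg_neg])
  have hc₂' : -c ≠ -1 := fun h => hc₁ (neg_injective h)
  have hS₁ : ∀ n : ℕ, 1 ≤ n → (-2 * N - 1 : ℂ) + α + 2 * n ≠ 0 := fun n hn => by
    rw [add_comm (-2 * N - 1 : ℂ)]; exact hS n hn
  have hu : ∀ n, 1 ≤ n → (uCoeff α (-2 * N - 1) c n = 0 ↔ n = 2 * N + 1) := fun n hn => by
    rw [uCoeff_comm]; exact uCoeff_eq_zero_iff_of_alpha hc₁ hc₂ hS₁ hn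
  have hα := ne_neg_odd_of_degenerate hS₁
  have hS' : ∀ n : ℕ, 1 ≤ n → α + (2 * N + 1 : ℂ) + 2 * n ≠ 0 := fun n hn => by
    rw [add_comm α]; exact shifted_sum_ne_zero hS₁ n hn
  have hN := two_mul_add_one_ne_neg_odd N
  have hT : ∀ n, n < 2 * N + 1 →
      tauBetaPow (2 * N + 1) α (-2 * N - 1) c (Q α (-2 * N - 1) c n) = 0 := fun n hn =>
    tauBetaPow_Q_of_lt _ _ _ hn
  have hT' := tauBetaPow_degenerate N α c
  have hlim := tendsto_hNorm_degenerate hc₁ hc₂ hS₁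
  have hlam := degenerateNorm_ne_zero hc₁ hc₂ hS₁
  have hv : ∀ n m, uFun₂ α (-2 * N - 1) c
      (tauBetaPow (2 * N + 1) α (-2 * N - 1) c (Q α (-2 * N - 1) c (2 * N + 1 + n)) *
        tauBetaPow (2 * N + 1) α (-2 * N - 1) c (Q α (-2 * N - 1) c (2 * N + 1 + m))) =
      uFun α (2 * N + 1) (-c) (Q α (2 * N + 1) (-c) n * Q α (2 * N + 1) (-c) m) := by
    intro n m
    have e : -(-2 * N - 1 : ℂ) = 2 * N + 1 := by ring
    rw [hT', hT', uFun₂, e]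
  refine ⟨_, hlam, ?_, favardFun α (-2 * N - 1) c, favardFun_one _ _ _, ?_, ?_⟩
  · simpa [normRatio_zero] using hlim 0
  · refine isDiscreteAtZeros_of_dvd (Q_monic_degree _ _ _ _).1.1.ne_zero ?_
    rintro _ ⟨f, rfl⟩
    rw [mul_comm (Q α (-2 * N - 1) c (2 * N + 1)) f]
    exact favardFun_mul_Q_of_uCoeff_eq_zero ((hu _ (by omega)).2 rfl) f 0
  · intro B hB
    have h := sobolevForm_favard (M := 2 * N) (h := hNorm α (2 * N + 1) (-c)) hS hu hlam hT
      (fun n m hnm => by rw [hv, uFun_orthogonal hα hN hS' hnm])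
      (fun n => by rw [hv, uFun_Q_mul_self hα hN hS'])
      (fun n => hNorm_ne_zero hc₁' hc₂' hα hN hS' n)
      (fun n => by rw [uCoeff_comm, uCoeff_shift, uCoeff_comm, hNorm_succ hS']) hB
    refine ⟨h.1, h.2.1, h.2.2.1, h.2.2.2.1, fun n => ?_, h.2.2.2.2⟩
    rw [normRatio_comm α]
    exact (hlim n).congr fun t => hNorm_comm _ _ _ _

end BigJacobi

theorem theorem1 (N : ℕ) (c : ℂ) (hc₁ : c ≠ 1) (hc₂ : c ≠ -1) :
    -- the functional `u` is given by the weight integral whenever that converges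
    (∀ α β : ℂ, -1 < α.re → -1 < β.re → ∀ p : ℂ[X],
      -- real `c`: integrals over `[-|c|, -1]` and `[1, |c|]`
      (∀ r : ℝ, (r : ℂ) = c →
        IntervalIntegrable (fun x : ℝ => p.eval (x : ℂ) * (((x / |x| : ℝ) : ℂ) * weight α β c x))
          volume (-|r|) (-1) ∧
        IntervalIntegrable (fun x : ℝ => p.eval (x : ℂ) * (((x / |x| : ℝ) : ℂ) * weight α β c x))
          volume 1 |r| ∧
        uFun α β c p =
          (∫ x in (-|r|)..(-1), p.eval (x : ℂ) * (((x / |x| : ℝ) : ℂ) * weight α β c x)) +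
          (∫ x in (1 : ℝ)..|r|, p.eval (x : ℂ) * (((x / |x| : ℝ) : ℂ) * weight α β c x))) ∧
      -- complex `c`: integrals along the curves `x = ±√(1 + (c² - 1)s)`, `0 ≤ s ≤ 1`
      (∀ γ : ℝ → ℂ, (∀ s, γ s = (1 + (c ^ 2 - 1) * (s : ℂ)) ^ (1 / 2 : ℂ)) →
        IntervalIntegrable (fun s : ℝ =>
            p.eval (γ s) * weight α β c (γ s) * ((c ^ 2 - 1) / (2 * γ s)) +
            p.eval (-γ s) * weight α β c (-γ s) * ((c ^ 2 - 1) / (2 * (-γ s)))) volume 0 1 ∧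
        uFun α β c p = ∫ s in (0 : ℝ)..1,
            (p.eval (γ s) * weight α β c (γ s) * ((c ^ 2 - 1) / (2 * γ s)) +
            p.eval (-γ s) * weight α β c (-γ s) * ((c ^ 2 - 1) / (2 * (-γ s)))))) ∧
    -- non-degenerate parameters: orthogonality and norms with respect to `u`
    (∀ α β : ℂ, (∀ n : ℕ, 1 ≤ n → α + β + 2 * n ≠ 0) →
      (∀ k : ℕ, α ≠ -(2 * k + 1)) → (∀ k : ℕ, β ≠ -(2 * k + 1)) →
      (∀ n m : ℕ, n ≠ m → uFun α β c (Q α β c n * Q α β c m) = 0) ∧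
      (∀ n : ℕ, uFun α β c (Q α β c n * Q α β c n) = hNorm α β c n) ∧
      (∀ n : ℕ, hNorm α β c n ≠ 0) ∧
      (∀ n : ℕ, 1 ≤ n → hNorm α β c n = uCoeff α β c n * hNorm α β c (n - 1))) ∧
    -- first degenerate case: `α = -2N-1`
    (∀ α β : ℂ, α = -2 * N - 1 → (∀ n : ℕ, 1 ≤ n → α + β + 2 * n ≠ 0) →
      Q α β c (2 * N + 1) = (X ^ 2 - 1) ^ N * (X - 1) ∧
      (∀ n : ℕ, n < 2 * N + 1 → tauAlphaPow (2 * N + 1) α β c (Q α β c n) = 0) ∧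
      (∀ n : ℕ, tauAlphaPow (2 * N + 1) α β c (Q α β c (2 * N + 1 + n)) =
        reflectX (Q (2 * N + 1) β (-c) n)) ∧
      (∀ n : ℕ, 1 ≤ n → (uCoeff α β c n = 0 ↔ n = 2 * N + 1)) ∧
      ∃ lam : ℂ, lam ≠ 0 ∧
        Tendsto (fun t : ℂ => hNorm t β c (2 * N + 1)) (𝓝[≠] α) (𝓝 lam) ∧
        ∃ ℓ₀ : ℂ[X] →ₗ[ℂ] ℂ, ℓ₀ 1 = 1 ∧
          IsDiscreteAtZeros ((X ^ 2 - 1) ^ N * (X - 1)) ℓ₀ ∧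
          ∀ B : ℂ[X] → ℂ[X] → ℂ,
            B = sobolevForm ℓ₀ lam (uFun₁ α β c) (tauAlphaPow (2 * N + 1) α β c) →
            (∀ n m : ℕ, n ≠ m → B (Q α β c n) (Q α β c m) = 0) ∧
            (∀ n : ℕ, B (Q α β c n) (Q α β c n) ≠ 0) ∧
            (∀ n : ℕ, n < 2 * N + 1 → B (Q α β c n) (Q α β c n) = normRatio α β c n) ∧
            (∀ n : ℕ, B (Q α β c (2 * N + 1 + n)) (Q α β c (2 * N + 1 + n)) =
              lam * hNorm (2 * N + 1) β (-c) n) ∧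
            (∀ n : ℕ, Tendsto (fun t : ℂ => hNorm t β c (2 * N + 1 + n)) (𝓝[≠] α)
              (𝓝 (lam * normRatio (2 * N + 1) β (-c) n))) ∧
            (∀ n : ℕ, 1 ≤ n → n ≠ 2 * N + 1 → B (Q α β c n) (Q α β c n) =
              uCoeff α β c n * B (Q α β c (n - 1)) (Q α β c (n - 1)))) ∧
    -- second degenerate case: `β = -2N-1`
    (∀ α β : ℂ, β = -2 * N - 1 → (∀ n : ℕ, 1 ≤ n → α + β + 2 * n ≠ 0) →
      Q α β c (2 * N + 1) = (X ^ 2 - C (c ^ 2)) ^ N * (X + C c) ∧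
      (∀ n : ℕ, n < 2 * N + 1 → tauBetaPow (2 * N + 1) α β c (Q α β c n) = 0) ∧
      (∀ n : ℕ, tauBetaPow (2 * N + 1) α β c (Q α β c (2 * N + 1 + n)) =
        Q α (2 * N + 1) (-c) n) ∧
      (∀ n : ℕ, 1 ≤ n → (uCoeff α β c n = 0 ↔ n = 2 * N + 1)) ∧
      ∃ lam : ℂ, lam ≠ 0 ∧
        Tendsto (fun t : ℂ => hNorm t α c (2 * N + 1)) (𝓝[≠] β) (𝓝 lam) ∧
        ∃ ℓ₁ : ℂ[X] →ₗ[ℂ] ℂ, ℓ₁ 1 = 1 ∧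
          IsDiscreteAtZeros ((X ^ 2 - C (c ^ 2)) ^ N * (X + C c)) ℓ₁ ∧
          ∀ B : ℂ[X] → ℂ[X] → ℂ,
            B = sobolevForm ℓ₁ lam (uFun₂ α β c) (tauBetaPow (2 * N + 1) α β c) →
            (∀ n m : ℕ, n ≠ m → B (Q α β c n) (Q α β c m) = 0) ∧
            (∀ n : ℕ, B (Q α β c n) (Q α β c n) ≠ 0) ∧
            (∀ n : ℕ, n < 2 * N + 1 → B (Q α β c n) (Q α β c n) = normRatio α β c n) ∧
            (∀ n : ℕ, B (Q α β c (2 * N + 1 + n)) (Q α β c (2 * N + 1 + n)) =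
              lam * hNorm α (2 * N + 1) (-c) n) ∧
            (∀ n : ℕ, Tendsto (fun t : ℂ => hNorm α t c (2 * N + 1 + n)) (𝓝[≠] β)
              (𝓝 (lam * normRatio α (2 * N + 1) (-c) n))) ∧
            (∀ n : ℕ, 1 ≤ n → n ≠ 2 * N + 1 → B (Q α β c n) (Q α β c n) =
              uCoeff α β c n * B (Q α β c (n - 1)) (Q α β c (n - 1)))) := by
  have he : c ^ 2 - 1 ≠ 0 := sq_sub_one_ne_zero hc₁ hc₂
  refine ⟨fun α β hα hβ p => ⟨?_, ?_⟩, fun α β hS hα hβ => ⟨?_, ?_, ?_, ?_⟩, ?_, ?_⟩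
  · rintro r rfl
    exact uFun_eq_real_integral hα hβ he p
  · intro γ hγ
    refine uFun_eq_curve_integral hα hβ he p fun s => ?_
    rw [hγ, one_div]
    exact Complex.cpow_nat_inv_pow _ two_ne_zero
  · exact fun n m hnm => uFun_orthogonal hα hβ hS hnm
  · exact uFun_Q_mul_self hα hβ hS
  · exact hNorm_ne_zero hc₁ hc₂ hα hβ hS
  · intro n hn
    obtain ⟨k, rfl⟩ := Nat.exists_eq_add_of_le' hn
    exact hNorm_succ hS c k
  · rintro _ β rfl hS
    rw [← Q_degenerate_alpha N β c hS]
    exact ⟨rfl, fun n hn => tauAlphaPow_Q_of_lt _ _ _ hn, tauAlphaPow_degenerate N β c,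
      fun n hn => uCoeff_eq_zero_iff_of_alpha hc₁ hc₂ hS hn,
      exists_sobolev_orthogonal_alpha hc₁ hc₂ hS⟩
  · rintro α _ rfl hS
    rw [← Q_degenerate_beta N α c hS]
    refine ⟨rfl, fun n hn => tauBetaPow_Q_of_lt _ _ _ hn, tauBetaPow_degenerate N α c,
      fun n hn => ?_, exists_sobolev_orthogonal_beta hc₁ hc₂ hS⟩
    rw [uCoeff_comm]
    exact uCoeff_eq_zero_iff_of_alpha hc₁ hc₂ (fun k hk => by
      rw [add_comm _ α]; exact hS k hk) hn
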